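/- **Structure of $\operatorname{Out}(\widehat M)$.** Let $F$ be the free group of rank $2$, $M = F/F''$ the free metabelian group of rank $2$, $A = M/M' \cong \mathbb{Z}^2$, $\widehat M$ the profinite completion of $M$, and $\widehat A\cong\widehat{\mathbb Z}^2$ the (profinite) abelianization of $\widehat M$. Automorphisms of profinite groups are continuous; $\operatorname{Out}(\widehat M) = \operatorname{Aut}(\widehat M)/\operatorname{Inn}(\widehat M)$, $\operatorname{GL}(\widehat A) = \operatorname{Aut}(\widehat A)$, and $\mathrm{ab}_* : \operatorname{Out}(\widehat M)\to \operatorname{GL}(\widehat A)$ is the induced map. Let $\widehat{\mathbb Z}[[\widehat A]] = \varprojlim (\mathbb Z/n)[\widehat A/U]$ be the completed group algebra, $\epsilon : \widehat{\mathbb Z}[[\widehat A]]\to\widehat{\mathbb Z}$ its augmentation, and $\widehat{\mathbb Z}[[\widehat A]]^{\times'}$ the group of units $u$ with $\epsilon(u) = 1$; it contains $\widehat A$. The conjugation action of $\widehat A$ makes the derived subgroup $\widehat M'$ a $\widehat{\mathbb Z}[[\widehat A]]$-module, written $m\mapsto m^r$. Let $c\in M'$ be a basis of the free rank one $\mathbb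 Z[A]$-module $M'$ (for example the commutator of two free generators of $M$). For every $\gamma\in\operatorname{Aut}(\widehat M)$ there is a unique unit $\det_c(\gamma)\in\widehat{\mathbb Z}[[\widehat A]]^\times$ with $\gamma(c) = c^{\det_c(\gamma)}$, and its class $\overline{\det}(\gamma)$ in $\widehat{\mathbb Z}[[\widehat A]]^\times/\widehat A$ depends only on the class of $\gamma$ in $\operatorname{Out}(\widehat M)$. Call $x\in\operatorname{Out}(\widehat M)$ *braid-like* if $\overline{\det}(x)$ is the class of $\det(\mathrm{ab}_*(x))\in\widehat{\mathbb Z}^\times$, and let $\operatorname{Out}^b(\widehat M)$ be the set of braid-like elements. Then: 1. The inverse of $\overline{\det}$ on $\ker(\mathrm{ab}_*)$ is a continuous homomorphism $\overline{\det}^{-1}$ that gives an exact sequence $$1\to\widehat{\mathbb Z}[[\widehat A]]^{\times'}/\widehat A\xrightarrow{\ \overline{\det}^{-1}\ }\operatorname{Out}(\widehat M)\xrightarrow{\ \mathrm{ab}_*\ }\operatorname{GL}(\widehat A)\to 1,$$ with $\mathrm{ab}_*$ continuous. 2. There is a continuous homomorphism $s : \operatorname{GL}(\widehat A)\to\operatorname{Out}(\widehat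 M)$ with $\mathrm{ab}_*\circ s = \mathrm{id}$ and image $\operatorname{Out}^b(\widehat M)$. In particular $\operatorname{Out}^b(\widehat M)$ is a subgroup that $\mathrm{ab}_*$ maps isomorphically onto $\operatorname{GL}(\widehat A)$. 3. Consequently $(k,g)\mapsto\overline{\det}^{-1}(k)\,s(g)$ is an isomorphism of topological groups $$\left(\widehat{\mathbb Z}[[\widehat A]]^{\times'}/\widehat A\right)\rtimes\operatorname{GL}(\widehat A)\ \cong\ \operatorname{Out}(\widehat M),$$ where $\operatorname{GL}(\widehat A)$ acts through its natural action on $\widehat A$, and $1\rtimes\operatorname{GL}(\widehat A)$ corresponds to $\operatorname{Out}^b(\widehat M)$. -/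

import Mathlib

open Topology

noncomputable section

/-! ### The profinite integers -/

/-- The ring `Ẑ = lim ℤ/n` of profinite integers, as compatible families of residues. -/
def zhatSubring : Subring (∀ n : ℕ+, ZMod n) where
  carrier := {f | ∀ (m n : ℕ+) (h : (m : ℕ) ∣ (n : ℕ)), ZMod.castHom h (ZMod m) (f n) = f m}
  mul_mem' := fun {f g} hf hg m n h => by
    simp only [Pi.mul_apply, map_mul, hf m n h, hg m n h]
  one_mem' := fun m n h => by simp only [Pi.one_apply, map_one]
  add_mem' := fun {f g} hf hg m n h => by
    simp only [Pi.add_apply, map_add, hf m n h, hg m n h]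
  zero_mem' := fun m n h => by simp only [Pi.zero_apply, map_zero]
  neg_mem' := fun {f} hf m n h => by simp only [Pi.neg_apply, map_neg, hf m n h]

/-- The profinite integers, with the subspace topology of `∏ ℤ/n` (each factor discrete). -/
abbrev ZHat : Type := zhatSubring

/-! ### The completed group algebra of an abelian profinite group -/

section CompletedGroupAlgebra

variable {Q : Type} [CommGroup Q] [TopologicalSpace Q]

/-- The transition map `(ℤ/n)[Q/V] → (ℤ/m)[Q/U]` for `m ∣ n` and `V ≤ U`. -/
def groupAlgebraTransition {m n : ℕ+} (h : (m : ℕ) ∣ (n : ℕ)) {U V : OpenSubgroup Q} (hUV : V ≤ U) :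
    MonoidAlgebra (ZMod n) (Q ⧸ V.toSubgroup) →+* MonoidAlgebra (ZMod m) (Q ⧸ U.toSubgroup) :=
  (MonoidAlgebra.mapRingHom (Q ⧸ U.toSubgroup) (ZMod.castHom h (ZMod m))).comp
    (MonoidAlgebra.mapDomainRingHom (ZMod n)
      (QuotientGroup.map V.toSubgroup U.toSubgroup (MonoidHom.id Q) hUV))

variable (Q) in
/-- The completed group algebra `Ẑ⟦Q⟧ = lim (ℤ/n)[Q/U]`, the limit running over `n ≥ 1` and the
open subgroups `U` of the abelian group `Q`, as compatible families. -/
def completedGroupAlgebraSubring :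
    Subring (∀ i : ℕ+ × OpenSubgroup Q, MonoidAlgebra (ZMod i.1) (Q ⧸ i.2.toSubgroup)) where
  carrier := {f | ∀ (m n : ℕ+) (h : (m : ℕ) ∣ (n : ℕ)) (U V : OpenSubgroup Q) (hUV : V ≤ U),
    groupAlgebraTransition h hUV (f (n, V)) = f (m, U)}
  mul_mem' := fun {f g} hf hg m n h U V hUV => by
    simp only [Pi.mul_apply, map_mul, hf m n h U V hUV, hg m n h U V hUV]
  one_mem' := fun m n h U V hUV => by simp only [Pi.one_apply, map_one]
  add_mem' := fun {f g} hf hg m n h U V hUV => by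
    simp only [Pi.add_apply, map_add, hf m n h U V hUV, hg m n h U V hUV]
  zero_mem' := fun m n h U V hUV => by simp only [Pi.zero_apply, map_zero]
  neg_mem' := fun {f} hf m n h U V hUV => by simp only [Pi.neg_apply, map_neg, hf m n h U V hUV]

variable (Q) in
/-- The completed group algebra `Ẑ⟦Q⟧`. -/
def CompletedGroupAlgebra : Type := completedGroupAlgebraSubring Q

instance : CommRing (CompletedGroupAlgebra Q) :=
  inferInstanceAs (CommRing (completedGroupAlgebraSubring Q))

namespace CompletedGroupAlgebra

/-- The projection `Ẑ⟦Q⟧ → (ℤ/n)[Q/U]`. -/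
def proj (n : ℕ+) (U : OpenSubgroup Q) :
    CompletedGroupAlgebra Q →+* MonoidAlgebra (ZMod n) (Q ⧸ U.toSubgroup) :=
  (Pi.evalRingHom (fun i : ℕ+ × OpenSubgroup Q =>
    MonoidAlgebra (ZMod i.1) (Q ⧸ i.2.toSubgroup)) (n, U)).comp
      (completedGroupAlgebraSubring Q).subtype

/-- The inverse limit topology, each `(ℤ/n)[Q/U]` being discrete. -/
instance : TopologicalSpace (CompletedGroupAlgebra Q) :=
  ⨅ i : ℕ+ × OpenSubgroup Q, TopologicalSpace.induced (fun f => proj i.1 i.2 f) ⊥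

theorem ext_proj {f g : CompletedGroupAlgebra Q} (h : ∀ n U, proj n U f = proj n U g) : f = g :=
  Subtype.ext (funext fun i => h i.1 i.2)

theorem transition_proj (f : CompletedGroupAlgebra Q) {m n : ℕ+} (h : (m : ℕ) ∣ (n : ℕ))
    {U V : OpenSubgroup Q} (hUV : V ≤ U) :
    groupAlgebraTransition h hUV (proj n V f) = proj m U f :=
  f.2 m n h U V hUV

theorem transition_single {m n : ℕ+} (h : (m : ℕ) ∣ (n : ℕ)) {U V : OpenSubgroup Q} (hUV : V ≤ U)
    (q : Q) (r : ZMod n) :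
    groupAlgebraTransition h hUV (MonoidAlgebra.single (QuotientGroup.mk q) r) =
      MonoidAlgebra.single (QuotientGroup.mk q) (ZMod.castHom h (ZMod m) r) := by
  simp only [groupAlgebraTransition, RingHom.comp_apply, MonoidAlgebra.mapDomainRingHom_apply,
    MonoidAlgebra.mapDomain_single, MonoidAlgebra.mapRingHom_single]
  rfl

/-- The canonical map `Q → Ẑ⟦Q⟧`, `q ↦ q`. -/
def of : Q →* CompletedGroupAlgebra Q where
  toFun q := ⟨fun i => MonoidAlgebra.single (QuotientGroup.mk q) 1, fun m n h U V hUV => by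
    simp only [transition_single, map_one]⟩
  map_one' := rfl
  map_mul' a b := Subtype.ext (funext fun i => by
    change MonoidAlgebra.single (QuotientGroup.mk (a * b) : Q ⧸ i.2.toSubgroup) (1 : ZMod i.1) =
      MonoidAlgebra.single (QuotientGroup.mk a) 1 * MonoidAlgebra.single (QuotientGroup.mk b) 1
    rw [MonoidAlgebra.single_mul_single, one_mul]; rfl)

/-- The structure homomorphism `Ẑ → Ẑ⟦Q⟧`. -/
def scalar : ZHat →+* CompletedGroupAlgebra Q :=
  (RingHom.pi fun i : ℕ+ × OpenSubgroup Q =>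
      ((MonoidAlgebra.singleOneRingHom :
          ZMod i.1 →+* MonoidAlgebra (ZMod i.1) (Q ⧸ i.2.toSubgroup)).comp
        (Pi.evalRingHom (fun n : ℕ+ => ZMod n) i.1)).comp zhatSubring.subtype).codRestrict
    (completedGroupAlgebraSubring Q) (fun z m n h U V hUV => by
      have := transition_single h hUV (1 : Q) (z.1 n)
      rw [z.2 m n h] at this
      exact this)

/-- The augmentation `(ℤ/n)[G] → ℤ/n`, sending every element of `G` to `1`. -/
def finiteAugmentation (n : ℕ+) (G : Type) [CommGroup G] : MonoidAlgebra (ZMod n) G →+* ZMod n :=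
  (MonoidAlgebra.lift (ZMod n) (ZMod n) G (1 : G →* ZMod n)).toRingHom

theorem finiteAugmentation_single (n : ℕ+) (G : Type) [CommGroup G] (g : G) (r : ZMod n) :
    finiteAugmentation n G (MonoidAlgebra.single g r) = r := by
  simp [finiteAugmentation]

theorem finiteAugmentation_transition {m n : ℕ+} (h : (m : ℕ) ∣ (n : ℕ)) {U V : OpenSubgroup Q}
    (hUV : V ≤ U) (x : MonoidAlgebra (ZMod n) (Q ⧸ V.toSubgroup)) :
    finiteAugmentation m _ (groupAlgebraTransition h hUV x) =
      ZMod.castHom h (ZMod m) (finiteAugmentation n _ x) := by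
  induction x using MonoidAlgebra.induction_linear with
  | zero => simp only [map_zero]
  | add f g hf hg => simp only [map_add, hf, hg]
  | single q r =>
    induction q using QuotientGroup.induction_on with
    | H q => rw [transition_single, finiteAugmentation_single, finiteAugmentation_single]

/-- The augmentation `ε : Ẑ⟦Q⟧ → Ẑ`, sending every element of `Q` to `1`. -/
def augmentation : CompletedGroupAlgebra Q →+* ZHat :=
  (RingHom.pi fun n : ℕ+ => (finiteAugmentation n (Q ⧸ (⊤ : OpenSubgroup Q).toSubgroup)).comp
    (proj n ⊤)).codRestrict zhatSubring (fun f m n h => by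
      change ZMod.castHom h (ZMod m) (finiteAugmentation n _ (proj n ⊤ f)) =
        finiteAugmentation m _ (proj m ⊤ f)
      rw [← transition_proj f h le_rfl, finiteAugmentation_transition])

/-- The map `(ℤ/n)[Q/φ⁻¹U] → (ℤ/n)[Q/U]` induced by a continuous endomorphism `φ` of `Q`. -/
def finiteMap (φ : Q →ₜ* Q) (n : ℕ+) (U : OpenSubgroup Q) :
    MonoidAlgebra (ZMod n) (Q ⧸ (U.comap φ.toMonoidHom φ.continuous_toFun).toSubgroup) →+*
      MonoidAlgebra (ZMod n) (Q ⧸ U.toSubgroup) :=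
  MonoidAlgebra.mapDomainRingHom (ZMod n)
    (QuotientGroup.map (U.comap φ.toMonoidHom φ.continuous_toFun).toSubgroup U.toSubgroup
      φ.toMonoidHom le_rfl)

theorem finiteMap_single (φ : Q →ₜ* Q) (n : ℕ+) (U : OpenSubgroup Q) (q : Q) (r : ZMod n) :
    finiteMap φ n U (MonoidAlgebra.single (QuotientGroup.mk q) r) =
      MonoidAlgebra.single (QuotientGroup.mk (φ q)) r := by
  simp only [finiteMap, MonoidAlgebra.mapDomainRingHom_apply, MonoidAlgebra.mapDomain_single]
  rfl

theorem finiteMap_transition (φ : Q →ₜ* Q) {m n : ℕ+} (h : (m : ℕ) ∣ (n : ℕ))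
    {U V : OpenSubgroup Q} (hUV : V ≤ U)
    (x : MonoidAlgebra (ZMod n) (Q ⧸ (V.comap φ.toMonoidHom φ.continuous_toFun).toSubgroup)) :
    groupAlgebraTransition h hUV (finiteMap φ n V x) =
      finiteMap φ m U (groupAlgebraTransition h
        (show V.comap φ.toMonoidHom φ.continuous_toFun ≤ U.comap φ.toMonoidHom φ.continuous_toFun
          from fun _ hx => hUV hx) x) := by
  induction x using MonoidAlgebra.induction_linear with
  | zero => simp only [map_zero]
  | add f g hf hg => simp only [map_add, hf, hg]
  | single q r =>
    induction q using QuotientGroup.induction_on with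
    | H q => rw [finiteMap_single, transition_single, transition_single, finiteMap_single]

/-- The ring endomorphism of `Ẑ⟦Q⟧` induced by functoriality by a continuous endomorphism
of `Q`. -/
def map (φ : Q →ₜ* Q) : CompletedGroupAlgebra Q →+* CompletedGroupAlgebra Q :=
  (RingHom.pi fun i : ℕ+ × OpenSubgroup Q => (finiteMap φ i.1 i.2).comp
      (proj i.1 (i.2.comap φ.toMonoidHom φ.continuous_toFun))).codRestrict
    (completedGroupAlgebraSubring Q) (fun f m n h U V hUV => by
      change groupAlgebraTransition h hUV (finiteMap φ n V (proj n _ f)) =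
        finiteMap φ m U (proj m _ f)
      rw [finiteMap_transition, transition_proj])

theorem proj_map (φ : Q →ₜ* Q) (n : ℕ+) (U : OpenSubgroup Q) (f : CompletedGroupAlgebra Q) :
    proj n U (map φ f) = finiteMap φ n U (proj n _ f) := rfl

theorem map_id (f : CompletedGroupAlgebra Q) : map (ContinuousMonoidHom.id Q) f = f := by
  refine ext_proj fun n U => ?_
  rw [proj_map]
  change finiteMap (ContinuousMonoidHom.id Q) n U (proj n U f) = proj n U f
  generalize proj n U f = x
  induction x using MonoidAlgebra.induction_linear with
  | zero => exact map_zero _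
  | add f g hf hg => exact (map_add _ f g).trans (congrArg₂ (· + ·) hf hg)
  | single q r =>
    induction q using QuotientGroup.induction_on with
    | H q => exact finiteMap_single _ n U q r

theorem map_comp (φ ψ : Q →ₜ* Q) (f : CompletedGroupAlgebra Q) :
    map (φ.comp ψ) f = map φ (map ψ f) := by
  refine ext_proj fun n U => ?_
  rw [proj_map, proj_map, proj_map]
  change finiteMap (φ.comp ψ) n U (proj n ((U.comap φ.toMonoidHom φ.continuous_toFun).comap
    ψ.toMonoidHom ψ.continuous_toFun) f) = _
  generalize proj n ((U.comap φ.toMonoidHom φ.continuous_toFun).comap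
    ψ.toMonoidHom ψ.continuous_toFun) f = x
  induction x using MonoidAlgebra.induction_linear with
  | zero => rw [map_zero, map_zero]; exact map_zero _
  | add f g hf hg =>
    rw [map_add, map_add]; exact (map_add _ f g).trans (congrArg₂ (· + ·) hf hg)
  | single q r =>
    induction q using QuotientGroup.induction_on with
    | H q =>
      rw [finiteMap_single, finiteMap_single]
      exact finiteMap_single _ n U q r

theorem map_of (φ : Q →ₜ* Q) (q : Q) : map φ (of q) = of (φ q) := by
  refine ext_proj fun n U => ?_
  rw [proj_map]
  exact finiteMap_single φ n U q 1

theorem finiteAugmentation_finiteMap (φ : Q →ₜ* Q) (n : ℕ+) (U : OpenSubgroup Q)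
    (x : MonoidAlgebra (ZMod n) (Q ⧸ (U.comap φ.toMonoidHom φ.continuous_toFun).toSubgroup)) :
    finiteAugmentation n _ (finiteMap φ n U x) = finiteAugmentation n _ x := by
  induction x using MonoidAlgebra.induction_linear with
  | zero => simp only [map_zero]
  | add f g hf hg => simp only [map_add, hf, hg]
  | single q r =>
    induction q using QuotientGroup.induction_on with
    | H q => rw [finiteMap_single, finiteAugmentation_single, finiteAugmentation_single]

theorem augmentation_of (q : Q) : augmentation (of q) = 1 :=
  Subtype.ext (funext fun n => finiteAugmentation_single n _ _ 1)

theorem augmentation_map (φ : Q →ₜ* Q) (f : CompletedGroupAlgebra Q) :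
    augmentation (map φ f) = augmentation f :=
  Subtype.ext (funext fun n => finiteAugmentation_finiteMap φ n ⊤ (proj n ⊤ f))

end CompletedGroupAlgebra

end CompletedGroupAlgebra

/-! ### Continuous automorphisms -/

section Automorphisms

variable (G : Type) [Group G] [TopologicalSpace G]

/-- The continuous automorphisms of a topological group, a group under composition. -/
abbrev ContAut : Type := G ≃ₜ* G

instance : Group (ContAut G) where
  mul f g := g.trans f
  one := ContinuousMulEquiv.refl G
  inv f := f.symm
  mul_assoc _ _ _ := rfl
  one_mul _ := rfl
  mul_one _ := rfl
  inv_mul_cancel f := ContinuousMulEquiv.ext fun x => f.toEquiv.symm_apply_apply x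

theorem ContAut.mul_apply (f g : ContAut G) (x : G) : (f * g) x = f (g x) := rfl

theorem ContAut.one_apply (x : G) : (1 : ContAut G) x = x := rfl

theorem ContAut.inv_apply_self (f : ContAut G) (x : G) : f⁻¹ (f x) = x :=
  f.toEquiv.symm_apply_apply x

theorem ContAut.apply_inv_self (f : ContAut G) (x : G) : f (f⁻¹ x) = x :=
  f.toEquiv.apply_symm_apply x

/-- The compact-open topology (for a finitely generated profinite group `G` this is the profinite
topology of `Aut(G)`). -/
instance : TopologicalSpace (ContAut G) :=
  TopologicalSpace.induced (fun γ => (⟨γ, γ.continuous_toFun⟩ : C(G, G))) inferInstance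

variable [IsTopologicalGroup G]

/-- `g ↦ (x ↦ g x g⁻¹)`. -/
def innerAut : G →* ContAut G where
  toFun g :=
    { MulAut.conj g with
      continuous_toFun := by
        change Continuous fun x => g * x * g⁻¹
        fun_prop
      continuous_invFun := by
        change Continuous fun x => g⁻¹ * x * g
        fun_prop }
  map_one' := ContinuousMulEquiv.ext fun x => by
    change 1 * x * 1⁻¹ = x
    simp
  map_mul' g h := ContinuousMulEquiv.ext fun x => by
    change g * h * x * (g * h)⁻¹ = g * (h * x * h⁻¹) * g⁻¹
    group

theorem innerAut_apply (g x : G) : innerAut G g x = g * x * g⁻¹ := rfl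

/-- The group of inner automorphisms. -/
def Inn : Subgroup (ContAut G) := (innerAut G).range

instance : (Inn G).Normal where
  conj_mem := by
    rintro _ ⟨g, rfl⟩ γ
    refine ⟨γ g, ContinuousMulEquiv.ext fun x => ?_⟩
    rw [ContAut.mul_apply, ContAut.mul_apply, innerAut_apply, innerAut_apply, map_mul, map_mul,
      map_inv, ContAut.apply_inv_self]

/-- The group of (continuous) outer automorphisms, with the quotient topology. -/
abbrev Out : Type := ContAut G ⧸ Inn G

variable {G}

theorem map_closedCommutator_le (γ : ContAut G) :
    (commutator G).topologicalClosure ≤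
      (commutator G).topologicalClosure.comap (γ : G →* G) := by
  refine Subgroup.topologicalClosure_minimal _ ?_ ?_
  · refine fun x hx => Subgroup.le_topologicalClosure _ ?_
    have h : (commutator G).map (γ : G →* G) ≤ commutator G := by
      rw [commutator_def, Subgroup.map_commutator]
      exact Subgroup.commutator_mono le_top le_top
    exact h ⟨x, hx, rfl⟩
  · exact (Subgroup.isClosed_topologicalClosure _).preimage γ.continuous_toFun

/-- The endomorphism of the abelianization `G / closure [G, G]` induced by an automorphism. -/
def abMap (γ : ContAut G) : TopologicalAbelianization G →* TopologicalAbelianization G :=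
  QuotientGroup.map _ _ (γ : G →* G) (map_closedCommutator_le γ)

theorem abMap_mk (γ : ContAut G) (x : G) :
    abMap γ (QuotientGroup.mk x) = QuotientGroup.mk (γ x) := rfl

theorem continuous_abMap (γ : ContAut G) : Continuous (abMap γ) :=
  (QuotientGroup.continuous_mk.comp γ.continuous_toFun).quotient_lift _

variable (G) in
/-- The map `ab_* : Aut(G) → Aut(Gᵃᵇ)`. -/
def autAb : ContAut G →* ContAut (TopologicalAbelianization G) where
  toFun γ :=
    { abMap γ with
      invFun := abMap γ⁻¹
      left_inv := fun x => by
        induction x using QuotientGroup.induction_on with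
        | H x => exact congrArg QuotientGroup.mk (ContAut.inv_apply_self G γ x)
      right_inv := fun x => by
        induction x using QuotientGroup.induction_on with
        | H x => exact congrArg QuotientGroup.mk (ContAut.apply_inv_self G γ x)
      continuous_toFun := continuous_abMap γ
      continuous_invFun := continuous_abMap γ⁻¹ }
  map_one' := ContinuousMulEquiv.ext fun x => by
    induction x using QuotientGroup.induction_on with
    | H x => rfl
  map_mul' γ δ := ContinuousMulEquiv.ext fun x => by
    induction x using QuotientGroup.induction_on with
    | H x => rfl

variable (G) in
/-- The map `ab_* : Out(G) → Aut(Gᵃᵇ)`. -/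
def outAb : Out G →* ContAut (TopologicalAbelianization G) :=
  QuotientGroup.lift (Inn G) (autAb G) (by
    rintro _ ⟨g, rfl⟩
    refine ContinuousMulEquiv.ext fun x => ?_
    induction x using QuotientGroup.induction_on with
    | H x =>
      change (QuotientGroup.mk (g * x * g⁻¹) : TopologicalAbelianization G) = QuotientGroup.mk x
      have h := mul_comm (QuotientGroup.mk g : TopologicalAbelianization G) (QuotientGroup.mk x)
      rw [QuotientGroup.mk_mul, QuotientGroup.mk_mul, QuotientGroup.mk_inv, h]
      exact mul_inv_cancel_right _ _)

end Automorphisms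

/-! ### Units of the completed group algebra -/

section Units

variable (Q : Type) [CommGroup Q] [TopologicalSpace Q]

/-- The canonical map `Q → Ẑ⟦Q⟧ˣ`. -/
def groupLike : Q →* (CompletedGroupAlgebra Q)ˣ := CompletedGroupAlgebra.of.toHomUnits

/-- The units of augmentation `1`. -/
def specialUnits : Subgroup (CompletedGroupAlgebra Q)ˣ :=
  (Units.map (CompletedGroupAlgebra.augmentation (Q := Q)).toMonoidHom).ker

/-- The group `Ẑ⟦Q⟧ˣ / Q`. -/
abbrev ReducedUnits : Type := (CompletedGroupAlgebra Q)ˣ ⧸ (groupLike Q).range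

/-- The group `Ẑ⟦Q⟧^{×'} / Q` of units of augmentation `1` modulo `Q`. -/
abbrev ReducedSpecialUnits : Type :=
  specialUnits Q ⧸ (groupLike Q).range.subgroupOf (specialUnits Q)

variable {Q}

theorem mem_specialUnits {u : (CompletedGroupAlgebra Q)ˣ} :
    u ∈ specialUnits Q ↔ CompletedGroupAlgebra.augmentation (u : CompletedGroupAlgebra Q) = 1 := by
  rw [specialUnits, MonoidHom.mem_ker, Units.ext_iff]
  rfl

/-- A continuous automorphism as a continuous homomorphism. -/
def ContAut.toHom (g : ContAut Q) : Q →ₜ* Q := ⟨(g : Q →* Q), g.continuous_toFun⟩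

/-- The automorphism of `Ẑ⟦Q⟧^{×'}` induced by functoriality by an automorphism of `Q`. -/
def specialUnitsMap (g : ContAut Q) : specialUnits Q →* specialUnits Q :=
  ((Units.map (CompletedGroupAlgebra.map g.toHom).toMonoidHom).comp
    (specialUnits Q).subtype).codRestrict (specialUnits Q) (fun u => by
      rw [mem_specialUnits]
      exact (CompletedGroupAlgebra.augmentation_map _ _).trans (mem_specialUnits.1 u.2))

theorem specialUnitsMap_one (u : specialUnits Q) : specialUnitsMap 1 u = u :=
  Subtype.ext (Units.ext (CompletedGroupAlgebra.map_id _))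

theorem specialUnitsMap_mul (g h : ContAut Q) (u : specialUnits Q) :
    specialUnitsMap (g * h) u = specialUnitsMap g (specialUnitsMap h u) :=
  Subtype.ext (Units.ext (CompletedGroupAlgebra.map_comp g.toHom h.toHom _))

/-- The endomorphism of `Ẑ⟦Q⟧^{×'} / Q` induced by an automorphism of `Q`. -/
def reducedMap (g : ContAut Q) : ReducedSpecialUnits Q →* ReducedSpecialUnits Q :=
  QuotientGroup.map _ _ (specialUnitsMap g) (by
    rintro u ⟨q, hq⟩
    refine ⟨g q, Units.ext ?_⟩
    have h : CompletedGroupAlgebra.of q = u.1 :=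
      congrArg Units.val hq
    change CompletedGroupAlgebra.of (g q) =
      CompletedGroupAlgebra.map g.toHom (u.1 : CompletedGroupAlgebra Q)
    rw [← h]
    exact (CompletedGroupAlgebra.map_of g.toHom q).symm)

theorem reducedMap_one (k : ReducedSpecialUnits Q) : reducedMap 1 k = k := by
  induction k using QuotientGroup.induction_on with
  | H u => exact congrArg QuotientGroup.mk (specialUnitsMap_one u)

theorem reducedMap_mul (g h : ContAut Q) (k : ReducedSpecialUnits Q) :
    reducedMap (g * h) k = reducedMap g (reducedMap h k) := by
  induction k using QuotientGroup.induction_on with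
  | H u => exact congrArg QuotientGroup.mk (specialUnitsMap_mul g h u)

variable (Q) in
/-- The natural action of `Aut(Q)` on `Ẑ⟦Q⟧^{×'} / Q`. -/
def naturalAction : ContAut Q →* MulAut (ReducedSpecialUnits Q) where
  toFun g :=
    { reducedMap g with
      invFun := reducedMap g⁻¹
      left_inv := fun k => by
        change reducedMap g⁻¹ (reducedMap g k) = k
        rw [← reducedMap_mul, inv_mul_cancel, reducedMap_one]
      right_inv := fun k => by
        change reducedMap g (reducedMap g⁻¹ k) = k
        rw [← reducedMap_mul, mul_inv_cancel, reducedMap_one] }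
  map_one' := MulEquiv.ext reducedMap_one
  map_mul' g h := MulEquiv.ext (reducedMap_mul g h)

end Units

/-! ### Determinants -/

section Determinants

/-- `HasDet g d`: the automorphism `g` of `Q ≅ Ẑ²` has determinant `d`, that is, in some
coordinates `e : Ẑ² ≅ Q` it is given by a matrix over `Ẑ` of determinant `d`. -/
def HasDet {Q : Type} [CommGroup Q] [TopologicalSpace Q] (g : ContAut Q) (d : ZHat) : Prop :=
  ∃ (e : Multiplicative (Fin 2 → ZHat) ≃ₜ* Q) (P : Matrix (Fin 2) (Fin 2) ZHat),
    (∀ v : Fin 2 → ZHat,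
      g (e (Multiplicative.ofAdd v)) = e (Multiplicative.ofAdd (P.mulVec v))) ∧
    P.det = d

variable {G : Type} [Group G] [TopologicalSpace G] [IsTopologicalGroup G]

/-- `IsPow m r d`: one has `d = m ^ r`, for the continuous action of `Ẑ⟦Gᵃᵇ⟧` on the closed
derived subgroup of `G` (when this is abelian) that extends the action of `Gᵃᵇ` by conjugation.
The orbit map `r ↦ m ^ r` is the continuous homomorphism `f : Ẑ⟦Gᵃᵇ⟧ → G` with
`f(ḡ) = g m g⁻¹` for `g : G`; there is at most one, since the elements of `Gᵃᵇ` generate a dense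
additive subgroup of `Ẑ⟦Gᵃᵇ⟧`. -/
def IsPow (m : G) (r : CompletedGroupAlgebra (TopologicalAbelianization G)) (d : G) : Prop :=
  ∃ f : Multiplicative (CompletedGroupAlgebra (TopologicalAbelianization G)) →* G,
    Continuous f ∧
    (∀ g : G, f (Multiplicative.ofAdd
      (CompletedGroupAlgebra.of (QuotientGroup.mk g : TopologicalAbelianization G))) =
        g * m * g⁻¹) ∧
    f (Multiplicative.ofAdd r) = d

/-- `IsBachmuthDet c γ u`: the unit `u` is the generalized Bachmuth determinant `det_c(γ)`, that is,
`γ(c) = c ^ u`. -/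
def IsBachmuthDet (c : G) (γ : ContAut G)
    (u : (CompletedGroupAlgebra (TopologicalAbelianization G))ˣ) : Prop :=
  IsPow c (u : CompletedGroupAlgebra (TopologicalAbelianization G)) (γ c)

/-- `IsReducedDet c x δ`: the class `δ` in `Ẑ⟦Gᵃᵇ⟧ˣ / Gᵃᵇ` is the reduced determinant of the outer
automorphism `x`, that is, the class of `det_c(γ)` for a representative `γ` of `x`. -/
def IsReducedDet (c : G) (x : Out G) (δ : ReducedUnits (TopologicalAbelianization G)) : Prop :=
  ∃ (γ : ContAut G) (u : (CompletedGroupAlgebra (TopologicalAbelianization G))ˣ),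
    (QuotientGroup.mk γ : Out G) = x ∧ IsBachmuthDet c γ u ∧ QuotientGroup.mk u = δ

/-- The braid-like outer automorphisms: those whose reduced determinant is the class of the
determinant of the induced automorphism of the abelianization. -/
def braidLike (c : G) : Set (Out G) :=
  {x | ∃ d : ZHatˣ, HasDet (outAb G x) (d : ZHat) ∧
    IsReducedDet c x (QuotientGroup.mk
      (Units.map (CompletedGroupAlgebra.scalar
        (Q := TopologicalAbelianization G)).toMonoidHom d))}

end Determinants

/-! ### The free profinite metabelian group of rank two -/

/-- The free metabelian group `M = F / F''` of rank two. -/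
abbrev FreeMetabelian : Type := FreeGroup (Fin 2) ⧸ derivedSeries (FreeGroup (Fin 2)) 2

/-- The profinite completion `M̂` of `M`. -/
abbrev MHat : ProfiniteGrp.{0} :=
  ProfiniteGrp.ProfiniteCompletion.completion (GrpCat.of FreeMetabelian)

/-- The abelianization `Â` of `M̂`. -/
abbrev AHat : Type := TopologicalAbelianization MHat

/-- The canonical map `M → M̂`. -/
def toMHat (m : FreeMetabelian) : MHat :=
  ProfiniteGrp.ProfiniteCompletion.etaFn (GrpCat.of FreeMetabelian) m

/-- `c` is a basis of the free rank one `ℤ[A]`-module `M'` (with `A = Mᵃᵇ` acting by conjugation).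
The submodule generated by `c` is the normal closure of `c`, and a generator of a free module of
rank one over a commutative ring is a basis. -/
def IsDerivedBasis (c : FreeMetabelian) : Prop :=
  Subgroup.normalClosure {c} = commutator FreeMetabelian

end

/-!
Write `R = Ẑ⟦Â⟧`, let `x, y` be the two generators, and also denote by `x, y` their images in `Â`.
The idea is to turn every question about `Out(M̂)` into linear algebra over the ring `R`.

`R` is the free profinite abelian group on the space `Â` (`CompletedGroupAlgebra.exists_lift`), so
every `m : M̂'` has a continuous orbit map `r ↦ m ^ r`, here `MHat.dpow m`. The derived subgroup
`M̂'` is free of rank one over `R` on the commutator `[x, y]` (`MHat.isBasis_genCommutator`): it is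
generated by `[x, y]` because modulo a closed normal subgroup containing `[x, y]` the group becomes
abelian, and the homomorphism from `M̂` to the affine group `R ⋊ Â` with `x ↦ (0, x)`, `y ↦ (1, y)`
sends `[x, y] ^ r` to the translation by `(x - 1) r`, where `x - 1` is a nonzerodivisor. The given
`c` generates the same module, so it is another basis, and an automorphism `γ` has a determinant
with `γ c = c ^ det γ`, which is a crossed homomorphism: `det (γ δ) = det γ * γ (det δ)`.

Three facts then describe `Out(M̂)` by the pairs `(ab_* γ, det γ)`.

* The augmentation of `det γ` is the determinant of `ab_* γ` (`MHat.IsBasis.augmentation_det`),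
  because the augmentation of the exponent of `[X, Y]` is an alternating bilinear form in `X, Y`.
* Every `g` in `GL(Â)` and every unit of augmentation `det g` occur together
  (`MHat.IsBasis.exists_contAut`): multiplying lifts `X, Y` of `g x, g y` by elements of `M̂'`
  changes the exponent of `[X, Y]` by an arbitrary element of the ideal `(g x - 1, g y - 1)`,
  which is the augmentation ideal.
* If `ab_* γ = 1` and `det γ = 1`, then `γ` is inner (`MHat.IsBasis.mem_inn_of_det_eq_one`): writing
  `γ x = x c ^ a` and `γ y = y c ^ b`, the condition `γ [x, y] = [x, y]` is a syzygy of
  `x - 1, y - 1`, and exactness of their Koszul complex yields an element of `M̂'` which conjugates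
  as `γ` does.

Hence `ι u` is the class of an automorphism with `ab_* = 1` and `det = u`, and `s g` that of an
automorphism with `ab_* = g` and `det` the scalar `det g`. The multiplicativity of `s` and the
formula for its conjugation action on `ι` come from the crossed homomorphism property, scalars being
fixed by `GL(Â)`. All groups in question are compact and Hausdorff; `Aut(M̂)` is compact because it
is the set of invertible elements of the compact monoid of endomorphisms, which is a continuous
image of `M̂ × M̂`. So `ι` and `s` are continuous because their graphs are images of compact sets, and
a continuous bijection of such groups is a homeomorphism.
-/

noncomputable section

/-! ### Compactness lemmas -/

/-- The closed graph theorem for maps to a compact space. -/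
theorem continuous_of_isClosed_graph {X Y : Type*} [TopologicalSpace X] [TopologicalSpace Y]
    [CompactSpace Y] {f : X → Y} (h : IsClosed {p : X × Y | p.2 = f p.1}) : Continuous f := by
  refine continuous_iff_isClosed.2 fun C hC => ?_
  have : f ⁻¹' C = Prod.fst '' ({p : X × Y | p.2 = f p.1} ∩ Prod.snd ⁻¹' C) := by
    ext x
    constructor
    · intro hx
      exact ⟨(x, f x), ⟨rfl, hx⟩, rfl⟩
    · rintro ⟨⟨a, b⟩, ⟨h1, h2⟩, rfl⟩
      change b = f a at h1
      subst h1
      exact h2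
  rw [this]
  exact isClosedMap_fst_of_compactSpace _ (h.inter (hC.preimage continuous_snd))

theorem totallyDisconnectedSpace_quotient {G : Type*} [Group G] [TopologicalSpace G]
    [IsTopologicalGroup G] [CompactSpace G] [TotallyDisconnectedSpace G] (K : Subgroup G)
    [K.Normal] (hK : IsClosed (K : Set G)) : TotallyDisconnectedSpace (G ⧸ K) := by
  suffices TotallySeparatedSpace (G ⧸ K) from inferInstance
  refine totallySeparatedSpace_iff_exists_isClopen.2 fun a b hab => ?_
  induction a using QuotientGroup.induction_on with
  | H g =>
  induction b using QuotientGroup.induction_on with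
  | H h =>
  -- Separate `g K` from `h K` by an open subgroup containing `K` but not `g⁻¹ h`.
  have hgh : g⁻¹ * h ∉ K := fun hh => hab (QuotientGroup.eq.2 hh)
  have key := ProfiniteGrp.closedSubgroup_eq_sInf_open (⟨K, hK⟩ : ClosedSubgroup G)
  have : ∃ N : Subgroup G, IsOpen (N : Set G) ∧ K ≤ N ∧ g⁻¹ * h ∉ N := by
    by_contra! hc
    apply hgh
    change g⁻¹ * h ∈ ((⟨K, hK⟩ : ClosedSubgroup G) : Subgroup G)
    rw [key]
    exact Subgroup.mem_sInf.2 fun N hN => hc N hN.1 hN.2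
  obtain ⟨N, hN, hKN, hgN⟩ := this
  let N' : OpenSubgroup (G ⧸ K) :=
    ⟨N.map (QuotientGroup.mk' K), QuotientGroup.isOpenMap_coe _ hN⟩
  refine ⟨(fun q => (g : G ⧸ K)⁻¹ * q) ⁻¹' N', N'.isClopen.preimage (by fun_prop), ?_, ?_⟩
  · change (g : G ⧸ K)⁻¹ * g ∈ N'
    rw [inv_mul_cancel]
    exact N'.one_mem
  · rintro ⟨n, hn, hn'⟩
    apply hgN
    have h2 : (n : G ⧸ K) = ((g⁻¹ * h : G) : G ⧸ K) := hn'
    have h3 := hKN (QuotientGroup.eq.1 h2)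
    have := N.mul_mem hn h3
    rwa [mul_inv_cancel_left] at this

theorem isClosed_setOf_apply_eq {ι : Type*} {X : ι → Type*} [∀ i, TopologicalSpace (X i)]
    [∀ i, DiscreteTopology (X i)] {i j : ι} (g : X i → X j) :
    IsClosed {f : ∀ i, X i | g (f i) = f j} :=
  isClosed_eq (continuous_of_discreteTopology.comp (continuous_apply i)) (continuous_apply j)

/-- A continuous function from a compact group to a discrete space is invariant under right
translation by an open subgroup. -/
theorem exists_openSubgroup_mul_eq {Q D : Type*} [Group Q] [TopologicalSpace Q]
    [IsTopologicalGroup Q] [CompactSpace Q] [TopologicalSpace D] [DiscreteTopology D] {f : Q → D}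
    (hf : Continuous f) : ∃ U : OpenSubgroup Q, ∀ q, ∀ u ∈ U, f (q * u) = f q := by
  -- The stabilizer of `f` is itself open: its complement is the projection of a closed set.
  refine ⟨⟨{ carrier := {u | ∀ q, f (q * u) = f q}
             mul_mem' := fun {a b} ha hb q => by rw [← mul_assoc, hb, ha]
             one_mem' := fun q => by rw [mul_one]
             inv_mem' := fun {a} ha q => by
               have := ha (q * a⁻¹)
               rw [inv_mul_cancel_right] at this
               exact this.symm }, ?_⟩, fun q u hu => hu q⟩
  rw [← isClosed_compl_iff]
  have h : IsClosed {p : Q × Q | f (p.1 * p.2) ≠ f p.1} := by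
    have hc : Continuous fun p : Q × Q => (f (p.1 * p.2), f p.1) := by fun_prop
    exact (isClosed_discrete {d : D × D | d.1 ≠ d.2}).preimage hc
  convert isClosedMap_snd_of_compactSpace _ h using 1
  ext u
  constructor
  · intro hu
    obtain ⟨q, hq⟩ := not_forall.1 hu
    exact ⟨(q, u), hq, rfl⟩
  · rintro ⟨⟨q, u⟩, hq, rfl⟩
    exact fun hc => hq (hc q)

/-! ### Topology of the completed group algebra -/

namespace CompletedGroupAlgebra

variable {Q : Type} [CommGroup Q] [TopologicalSpace Q]

theorem isOpen_preimage_proj (n : ℕ+) (U : OpenSubgroup Q)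
    (S : Set (MonoidAlgebra (ZMod n) (Q ⧸ U.toSubgroup))) : IsOpen (proj n U ⁻¹' S) := by
  let : TopologicalSpace (MonoidAlgebra (ZMod n) (Q ⧸ U.toSubgroup)) := ⊥
  have : DiscreteTopology (MonoidAlgebra (ZMod n) (Q ⧸ U.toSubgroup)) := ⟨rfl⟩
  have : Continuous (proj n U) :=
    continuous_iff_le_induced.2 (iInf_le (fun i : ℕ+ × OpenSubgroup Q =>
      TopologicalSpace.induced (fun f : CompletedGroupAlgebra Q => proj i.1 i.2 f) ⊥) (n, U))
  exact (isOpen_discrete S).preimage this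

theorem continuous_of_proj {X : Type*} [TopologicalSpace X] {f : X → CompletedGroupAlgebra Q}
    (h : ∀ n U a, IsOpen {x | proj n U (f x) = a}) : Continuous f := by
  refine continuous_iInf_rng.2 fun i => continuous_induced_rng.2 ?_
  let : TopologicalSpace (MonoidAlgebra (ZMod i.1) (Q ⧸ i.2.toSubgroup)) := ⊥
  have : DiscreteTopology (MonoidAlgebra (ZMod i.1) (Q ⧸ i.2.toSubgroup)) := ⟨rfl⟩
  exact continuous_discrete_rng.2 fun a => h i.1 i.2 a

theorem continuous_of_proj_eq {X : Type*} [TopologicalSpace X] {f : X → CompletedGroupAlgebra Q}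
    (h : ∀ n U x, ∀ᶠ y in 𝓝 x, proj n U (f y) = proj n U (f x)) : Continuous f := by
  refine continuous_of_proj fun n U a => isOpen_iff_mem_nhds.2 fun x hx => ?_
  filter_upwards [h n U x] with y hy
  exact hy.trans hx

theorem eventually_proj_eq (n : ℕ+) (U : OpenSubgroup Q) (f : CompletedGroupAlgebra Q) :
    ∀ᶠ g in 𝓝 f, proj n U g = proj n U f :=
  (isOpen_preimage_proj n U {proj n U f}).mem_nhds rfl

instance : IsTopologicalRing (CompletedGroupAlgebra Q) where
  continuous_add := continuous_of_proj_eq fun n U p => by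
    filter_upwards [(eventually_proj_eq n U p.1).prod_nhds (eventually_proj_eq n U p.2)] with q hq
    rw [map_add, map_add, hq.1, hq.2]
  continuous_mul := continuous_of_proj_eq fun n U p => by
    filter_upwards [(eventually_proj_eq n U p.1).prod_nhds (eventually_proj_eq n U p.2)] with q hq
    rw [map_mul, map_mul, hq.1, hq.2]
  continuous_neg := continuous_of_proj_eq fun n U p => by
    filter_upwards [eventually_proj_eq n U p] with q hq
    rw [map_neg, map_neg, hq]

/-- The system defining `Ẑ⟦Q⟧` is directed, so that single projections define a basis of
neighbourhoods. -/
theorem exists_proj_subset_of_mem_nhds {f : CompletedGroupAlgebra Q}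
    {s : Set (CompletedGroupAlgebra Q)} (hs : s ∈ 𝓝 f) :
    ∃ n U, {g | proj n U g = proj n U f} ⊆ s := by
  have hb : (𝓝 f).HasBasis (fun _ : ℕ+ × OpenSubgroup Q => True)
      (fun i => {g | proj i.1 i.2 g = proj i.1 i.2 f}) := by
    have h1 : 𝓝 f = ⨅ i : ℕ+ × OpenSubgroup Q,
        Filter.principal {g : CompletedGroupAlgebra Q | proj i.1 i.2 g = proj i.1 i.2 f} := by
      rw [show 𝓝 f = _ from nhds_iInf]
      refine iInf_congr fun i => ?_
      let : TopologicalSpace (MonoidAlgebra (ZMod i.1) (Q ⧸ i.2.toSubgroup)) := ⊥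
      have : DiscreteTopology (MonoidAlgebra (ZMod i.1) (Q ⧸ i.2.toSubgroup)) := ⟨rfl⟩
      rw [nhds_induced, nhds_discrete, Filter.comap_pure]
      rfl
    rw [h1]
    refine Filter.hasBasis_iInf_principal ?_
    rintro ⟨m, U⟩ ⟨n, V⟩
    refine ⟨(m * n, U ⊓ V), fun g hg => ?_, fun g hg => ?_⟩
    · have h2 : (m : ℕ) ∣ ((m * n : ℕ+) : ℕ) := ⟨n, by simp⟩
      change proj m U g = proj m U f
      rw [← transition_proj g h2 (inf_le_left : U ⊓ V ≤ U),
        ← transition_proj f h2 (inf_le_left : U ⊓ V ≤ U)]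
      exact congrArg _ hg
    · have h2 : (n : ℕ) ∣ ((m * n : ℕ+) : ℕ) := ⟨m, by simp [mul_comm]⟩
      change proj n V g = proj n V f
      rw [← transition_proj g h2 (inf_le_right : U ⊓ V ≤ V),
        ← transition_proj f h2 (inf_le_right : U ⊓ V ≤ V)]
      exact congrArg _ hg
  obtain ⟨i, -, hi⟩ := hb.mem_iff.1 hs
  exact ⟨i.1, i.2, hi⟩

theorem exists_proj_ne {f g : CompletedGroupAlgebra Q} (h : f ≠ g) :
    ∃ n U, proj n U f ≠ proj n U g := by
  by_contra! hc
  exact h (ext_proj hc)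

instance : TotallyDisconnectedSpace (CompletedGroupAlgebra Q) := by
  suffices TotallySeparatedSpace (CompletedGroupAlgebra Q) from inferInstance
  refine totallySeparatedSpace_iff_exists_isClopen.2 fun f g hfg => ?_
  obtain ⟨n, U, h⟩ := exists_proj_ne hfg
  refine ⟨proj n U ⁻¹' {proj n U f}, ⟨⟨?_⟩, isOpen_preimage_proj n U _⟩, rfl, fun hg => h hg.symm⟩
  exact isOpen_preimage_proj n U {proj n U f}ᶜ

instance : T2Space (CompletedGroupAlgebra Q) := by
  refine ⟨fun f g hfg => ?_⟩
  obtain ⟨n, U, h⟩ := exists_proj_ne hfg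
  refine ⟨_, _, isOpen_preimage_proj n U {proj n U f}, isOpen_preimage_proj n U {proj n U g},
    rfl, rfl, ?_⟩
  exact Disjoint.preimage _ (Set.disjoint_singleton.2 h)

instance [IsTopologicalGroup Q] [CompactSpace Q] : CompactSpace (CompletedGroupAlgebra Q) := by
  let : ∀ i : ℕ+ × OpenSubgroup Q,
    TopologicalSpace (MonoidAlgebra (ZMod i.1) (Q ⧸ i.2.toSubgroup)) := fun _ => ⊥
  have : ∀ i : ℕ+ × OpenSubgroup Q,
    DiscreteTopology (MonoidAlgebra (ZMod i.1) (Q ⧸ i.2.toSubgroup)) := fun _ => ⟨rfl⟩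
  have : ∀ i : ℕ+ × OpenSubgroup Q, Finite (MonoidAlgebra (ZMod i.1) (Q ⧸ i.2.toSubgroup)) := by
    intro i
    have : Finite (Q ⧸ i.2.toSubgroup) := i.2.toSubgroup.quotient_finite_of_isOpen i.2.isOpen
    have : NeZero (i.1 : ℕ) := ⟨i.1.ne_zero⟩
    exact Finite.of_equiv (Q ⧸ i.2.toSubgroup → ZMod i.1)
      (Finsupp.equivFunOnFinite.symm.trans MonoidAlgebra.coeffEquiv.symm)
  let j : CompletedGroupAlgebra Q →
    ∀ i : ℕ+ × OpenSubgroup Q, MonoidAlgebra (ZMod i.1) (Q ⧸ i.2.toSubgroup) := fun f i =>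
    proj i.1 i.2 f
  have hj : IsInducing j := by
    refine ⟨?_⟩
    rw [Pi.topologicalSpace, induced_iInf]
    simp only [induced_compose]
    rfl
  have hr : Set.range j = {f | ∀ (m n : ℕ+) (h : (m : ℕ) ∣ (n : ℕ)) (U V : OpenSubgroup Q)
      (hUV : V ≤ U), groupAlgebraTransition h hUV (f (n, V)) = f (m, U)} := by
    ext f
    constructor
    · rintro ⟨g, rfl⟩
      exact g.2
    · intro hf
      exact ⟨⟨f, hf⟩, rfl⟩
  have hcl : IsClosed (Set.range j) := by
    rw [hr]
    simp only [Set.ofPred_forall]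
    refine isClosed_iInter fun m => isClosed_iInter fun n => isClosed_iInter fun h =>
      isClosed_iInter fun U => isClosed_iInter fun V => isClosed_iInter fun hUV => ?_
    exact isClosed_setOf_apply_eq
      (X := fun i : ℕ+ × OpenSubgroup Q => MonoidAlgebra (ZMod i.1) (Q ⧸ i.2.toSubgroup))
      (i := (n, V)) (j := (m, U)) (groupAlgebraTransition h hUV)
  exact (IsClosedEmbedding.mk hj.isEmbedding hcl).compactSpace

theorem proj_of (n : ℕ+) (U : OpenSubgroup Q) (q : Q) :
    proj n U (of q) = MonoidAlgebra.single (QuotientGroup.mk q) 1 := rfl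

/-- Density of the span of `Q` in `Ẑ⟦Q⟧`, as an induction principle: a closed subgroup containing
`Q` is everything. -/
theorem mem_of_isClosed {S : AddSubgroup (CompletedGroupAlgebra Q)}
    (hS : IsClosed (S : Set (CompletedGroupAlgebra Q))) (h : ∀ q, of q ∈ S)
    (r : CompletedGroupAlgebra Q) : r ∈ S := by
  have key : ∀ (n : ℕ+) (U : OpenSubgroup Q) (a : MonoidAlgebra (ZMod n) (Q ⧸ U.toSubgroup)),
      ∃ s ∈ S, proj n U s = a := by
    intro n U a
    induction a using MonoidAlgebra.induction_linear with
    | zero => exact ⟨0, S.zero_mem, map_zero _⟩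
    | add f g hf hg =>
      obtain ⟨s, hs, rfl⟩ := hf
      obtain ⟨t, ht, rfl⟩ := hg
      exact ⟨s + t, S.add_mem hs ht, map_add _ _ _⟩
    | single q k =>
      induction q using QuotientGroup.induction_on with
      | H q =>
        obtain ⟨k, rfl⟩ := ZMod.intCast_surjective k
        refine ⟨k • of q, S.zsmul_mem (h q) k, ?_⟩
        rw [map_zsmul, proj_of]
        ext x
        simp
  have hr : r ∈ closure (S : Set (CompletedGroupAlgebra Q)) := by
    refine mem_closure_iff_nhds.2 fun t ht => ?_
    obtain ⟨n, U, hU⟩ := exists_proj_subset_of_mem_nhds ht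
    obtain ⟨s, hs, hs'⟩ := key n U (proj n U r)
    exact ⟨s, hU hs', hs⟩
  rwa [hS.closure_eq] at hr

/-- Two continuous homomorphisms on `Ẑ⟦Q⟧` which agree on `Q` are equal. -/
theorem monoidHom_ext {H : Type*} [Group H] [TopologicalSpace H] [T2Space H]
    {f g : Multiplicative (CompletedGroupAlgebra Q) →* H} (hf : Continuous f) (hg : Continuous g)
    (h : ∀ q, f (.ofAdd (of q)) = g (.ofAdd (of q))) : f = g := by
  let S : AddSubgroup (CompletedGroupAlgebra Q) := Subgroup.toAddSubgroup' (f.eqLocus g)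
  have hS : IsClosed (S : Set (CompletedGroupAlgebra Q)) := isClosed_eq hf hg
  exact MonoidHom.ext fun r => mem_of_isClosed hS h r.toAdd

theorem continuous_of [IsTopologicalGroup Q] : Continuous (of : Q →* CompletedGroupAlgebra Q) := by
  refine continuous_of_proj_eq fun n U q => ?_
  have h : {p : Q | q⁻¹ * p ∈ U} ∈ 𝓝 q :=
    (U.isOpen.preimage (by fun_prop : Continuous fun p => q⁻¹ * p)).mem_nhds
      (by change q⁻¹ * q ∈ U; rw [inv_mul_cancel]; exact U.one_mem)
  filter_upwards [h] with p hp
  rw [proj_of, proj_of, QuotientGroup.eq.2 hp]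

theorem continuous_map (φ : Q →ₜ* Q) : Continuous (map φ) := by
  refine continuous_of_proj_eq fun n U f => ?_
  filter_upwards [eventually_proj_eq n (U.comap φ.toMonoidHom φ.continuous_toFun) f] with g hg
  rw [proj_map, proj_map, hg]

theorem continuous_scalar : Continuous (scalar (Q := Q)) := by
  refine continuous_of_proj_eq fun n U z => ?_
  have hc : Continuous fun w : ZHat => w.1 n := (continuous_apply n).comp continuous_subtype_val
  filter_upwards [((isOpen_discrete {z.1 n}).preimage hc).mem_nhds rfl] with w hw
  change MonoidAlgebra.singleOneRingHom (w.1 n) = MonoidAlgebra.singleOneRingHom (z.1 n)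
  rw [show w.1 n = z.1 n from hw]

theorem continuous_augmentation : Continuous (augmentation (Q := Q)) := by
  refine continuous_induced_rng.2 (continuous_pi fun n => ?_)
  refine continuous_discrete_rng.2 fun a => ?_
  exact isOpen_preimage_proj n ⊤ (finiteAugmentation n _ ⁻¹' {a})

theorem map_scalar (φ : Q →ₜ* Q) (z : ZHat) : map φ (scalar z) = scalar z :=
  ext_proj fun n U => by
    rw [proj_map]
    refine (finiteMap_single φ n U 1 (z.1 n)).trans ?_
    rw [map_one]
    rfl

theorem augmentation_scalar (z : ZHat) : augmentation (scalar (Q := Q) z) = z :=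
  Subtype.ext (funext fun n => finiteAugmentation_single n _ _ (z.1 n))

/-- `Ẑ⟦Q⟧` is the free profinite abelian group on the space `Q`. -/
theorem exists_lift [IsTopologicalGroup Q] [CompactSpace Q] {B : Type*} [CommGroup B]
    [TopologicalSpace B] [IsTopologicalGroup B] [CompactSpace B] [TotallyDisconnectedSpace B]
    {f : Q → B} (hf : Continuous f) :
    ∃ F : Multiplicative (CompletedGroupAlgebra Q) →* B, Continuous F ∧
      ∀ q, F (.ofAdd (of q)) = f q := by
  -- The lift exists modulo each open subgroup `N` of `B`, as `f` mod `N` is defined on some `Q/U`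
  -- and `B/N` is killed by its order `n`.
  have step : ∀ N : OpenSubgroup B, ∃ ψ : CompletedGroupAlgebra Q →+ Additive (B ⧸ N.toSubgroup),
      (∃ n U, ∀ r, proj n U r = 0 → ψ r = 0) ∧
      ∀ q, ψ (of q) = Additive.ofMul (QuotientGroup.mk (f q)) := by
    intro N
    have : Finite (B ⧸ N.toSubgroup) := N.toSubgroup.quotient_finite_of_isOpen N.isOpen
    have : DiscreteTopology (B ⧸ N.toSubgroup) := QuotientGroup.discreteTopology N.isOpen
    obtain ⟨U, hU⟩ := exists_openSubgroup_mul_eq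
      (QuotientGroup.continuous_mk.comp hf : Continuous fun q => (f q : B ⧸ N.toSubgroup))
    let n : ℕ+ := ⟨Nat.card (B ⧸ N.toSubgroup), Nat.card_pos⟩
    let : Module (ZMod n) (Additive (B ⧸ N.toSubgroup)) :=
      AddCommGroup.zmodModule (fun x => pow_card_eq_one' (x := x.toMul))
    let v : Q ⧸ U.toSubgroup → Additive (B ⧸ N.toSubgroup) := fun q =>
      Quotient.liftOn' q (fun q => Additive.ofMul (QuotientGroup.mk (f q))) (fun a b hab => by
        have h1 := QuotientGroup.leftRel_apply.1 hab
        have h2 := hU a _ h1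
        rw [mul_inv_cancel_left] at h2
        exact congrArg Additive.ofMul h2.symm)
    let ψ₀ : (Q ⧸ U.toSubgroup →₀ ZMod n) →+ Additive (B ⧸ N.toSubgroup) :=
      (Finsupp.linearCombination (ZMod n) v).toAddMonoidHom
    refine ⟨(ψ₀.comp MonoidAlgebra.coeffAddEquiv.toAddMonoidHom).comp (proj n U).toAddMonoidHom,
      ⟨n, U, fun r hr => ?_⟩, fun q => ?_⟩
    · change ψ₀ (proj n U r).coeff = 0
      rw [hr]
      exact map_zero _
    · change ψ₀ (proj n U (of q)).coeff = _
      rw [proj_of, MonoidAlgebra.coeff_single]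
      refine (Finsupp.linearCombination_single (ZMod n) _ _).trans ?_
      rw [one_smul]
      rfl
  -- The graph of the lift is the closed subgroup generated by the pairs `(q, f q)`.
  let T₀ : Subgroup (Multiplicative (CompletedGroupAlgebra Q) × B) :=
    Subgroup.closure (Set.range fun q => (.ofAdd (of q), f q))
  let T := T₀.topologicalClosure
  have hT : IsClosed (T : Set (Multiplicative (CompletedGroupAlgebra Q) × B)) :=
    Subgroup.isClosed_topologicalClosure _
  have hmem : ∀ q, (Multiplicative.ofAdd (of q), f q) ∈ T := fun q =>
    Subgroup.le_topologicalClosure _ (Subgroup.subset_closure ⟨q, rfl⟩)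
  have hN : ∀ (N : OpenSubgroup B), ∀ p ∈ T, p.1 = 1 → p.2 ∈ N := by
    intro N p hp hp1
    obtain ⟨ψ, ⟨n, U, hψ⟩, hψ'⟩ := step N
    have : DiscreteTopology (B ⧸ N.toSubgroup) := QuotientGroup.discreteTopology N.isOpen
    let a : Multiplicative (CompletedGroupAlgebra Q) × B →* B ⧸ N.toSubgroup :=
      (AddMonoidHom.toMultiplicativeLeft ψ).comp (MonoidHom.fst _ _)
    let b : Multiplicative (CompletedGroupAlgebra Q) × B →* B ⧸ N.toSubgroup :=
      (QuotientGroup.mk' _).comp (MonoidHom.snd _ _)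
    have hψc : Continuous fun r : CompletedGroupAlgebra Q => (ψ r).toMul := by
      refine continuous_iff_continuousAt.2 fun r => ?_
      refine (continuousAt_const (y := (ψ r).toMul)).congr ?_
      filter_upwards [eventually_proj_eq n U r] with s hs
      have := hψ (r - s) (by rw [map_sub, hs, sub_self])
      rw [map_sub, sub_eq_zero] at this
      rw [this]
    have ha : Continuous a := hψc.comp continuous_fst
    have hb : Continuous b := QuotientGroup.continuous_mk.comp continuous_snd
    have hle : T ≤ a.eqLocus b := by
      refine Subgroup.topologicalClosure_minimal _ ?_ (isClosed_eq ha hb)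
      rw [Subgroup.closure_le]
      rintro _ ⟨q, rfl⟩
      exact congrArg Additive.toMul (hψ' q)
    have h1 : a p = b p := hle hp
    have h2 : a p = 1 := by
      change (ψ p.1.toAdd).toMul = 1
      rw [hp1]
      exact congrArg Additive.toMul (map_zero ψ)
    rw [h2] at h1
    exact (QuotientGroup.eq_one_iff _).1 h1.symm
  have huniq : ∀ p ∈ T, p.1 = 1 → p.2 = 1 := by
    intro p hp hp1
    by_contra hne
    obtain ⟨N, hN'⟩ := ProfiniteGrp.exist_openNormalSubgroup_sub_open_nhds_of_one
      (isOpen_compl_singleton (x := p.2)) (fun h => hne h.symm)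
    exact hN' (hN N.toOpenSubgroup p hp hp1) rfl
  have hex : ∀ r : Multiplicative (CompletedGroupAlgebra Q), ∃ b, (r, b) ∈ T := by
    let S : AddSubgroup (CompletedGroupAlgebra Q) :=
      Subgroup.toAddSubgroup' (T.map (MonoidHom.fst _ _))
    have hS : IsClosed (S : Set (CompletedGroupAlgebra Q)) :=
      isClosedMap_fst_of_compactSpace _ hT
    intro r
    obtain ⟨⟨r', b⟩, hb, rfl⟩ := mem_of_isClosed hS (fun q => ⟨_, hmem q, rfl⟩) r.toAdd
    exact ⟨b, hb⟩
  choose F hF using hex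
  have hF' : ∀ r b, (r, b) ∈ T → b = F r := by
    intro r b hb
    have := huniq _ (T.mul_mem hb (T.inv_mem (hF r))) (mul_inv_cancel r)
    exact mul_inv_eq_one.1 this
  refine ⟨MonoidHom.mk' F fun r s => ?_, ?_, fun q => (hF' _ _ (hmem q)).symm⟩
  · exact (hF' _ _ (T.mul_mem (hF r) (hF s))).symm
  · refine continuous_of_isClosed_graph ?_
    convert hT using 1
    ext ⟨r, b⟩
    exact ⟨fun h => by change b = F r at h; rw [h]; exact hF r, fun h => hF' r b h⟩

end CompletedGroupAlgebra

/-! ### Generators and universal property of the free profinite metabelian group -/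

section Metabelian

open scoped commutatorElement

theorem derivedSeries_two_eq_bot {H : Type*} [Group H]
    (hH : ∀ a b c d : H, ⁅⁅a, b⁆, ⁅c, d⁆⁆ = 1) : derivedSeries H 2 = ⊥ := by
  have h1 : ∀ c d : H, commutator H ≤ Subgroup.centralizer {⁅c, d⁆} := fun c d => by
    refine Subgroup.commutator_le.2 fun a _ b _ => ?_
    rw [Subgroup.mem_centralizer_singleton_iff]
    exact (commutatorElement_eq_one_iff_mul_comm.1 (hH a b c d))
  have h2 : ∀ u ∈ commutator H, commutator H ≤ Subgroup.centralizer {u} := fun u hu => by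
    refine Subgroup.commutator_le.2 fun c _ d _ => ?_
    have := h1 c d hu
    rw [Subgroup.mem_centralizer_singleton_iff] at this ⊢
    exact this.symm
  change ⁅⁅(⊤ : Subgroup H), ⊤⁆, ⁅(⊤ : Subgroup H), ⊤⁆⁆ = ⊥
  rw [eq_bot_iff, Subgroup.commutator_le]
  intro u hu v hv
  have := h2 v hv hu
  rw [Subgroup.mem_centralizer_singleton_iff] at this
  exact Subgroup.mem_bot.2 (commutatorElement_eq_one_iff_mul_comm.2 this)

theorem FreeMetabelian.commutator_commutator (a b c d : FreeMetabelian) :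
    ⁅⁅a, b⁆, ⁅c, d⁆⁆ = 1 := by
  induction a using QuotientGroup.induction_on with
  | H a =>
  induction b using QuotientGroup.induction_on with
  | H b =>
  induction c using QuotientGroup.induction_on with
  | H c =>
  induction d using QuotientGroup.induction_on with
  | H d =>
  refine (QuotientGroup.eq_one_iff (⁅⁅a, b⁆, ⁅c, d⁆⁆ : FreeGroup (Fin 2))).2 ?_
  exact Subgroup.commutator_mem_commutator
    (Subgroup.commutator_mem_commutator (Subgroup.mem_top a) (Subgroup.mem_top b))
    (Subgroup.commutator_mem_commutator (Subgroup.mem_top c) (Subgroup.mem_top d))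

end Metabelian

namespace MHat

/-- The canonical homomorphism from the free group to `M̂`. -/
def ofFree : FreeGroup (Fin 2) →* MHat :=
  (ProfiniteGrp.ProfiniteCompletion.eta (GrpCat.of FreeMetabelian)).hom.comp
    (QuotientGroup.mk' (derivedSeries (FreeGroup (Fin 2)) 2))

/-- The images in `M̂` of the two free generators. -/
def gen (i : Fin 2) : MHat := ofFree (FreeGroup.of i)

theorem denseRange_ofFree : DenseRange ofFree := by
  have h := (QuotientGroup.mk'_surjective (derivedSeries (FreeGroup (Fin 2)) 2)).range_comp toMHat
  change Dense (Set.range (toMHat ∘ QuotientGroup.mk' (derivedSeries (FreeGroup (Fin 2)) 2)))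
  rw [h]
  exact ProfiniteGrp.ProfiniteCompletion.denseRange (GrpCat.of FreeMetabelian)

/-- `M̂` is topologically generated by `gen 0` and `gen 1`. -/
theorem mem_of_gen_mem {S : Subgroup MHat} (hS : IsClosed (S : Set MHat)) (h : ∀ i, gen i ∈ S)
    (z : MHat) : z ∈ S := by
  have h1 : S.comap ofFree = ⊤ := by
    rw [eq_top_iff, ← FreeGroup.closure_range_of, Subgroup.closure_le]
    rintro _ ⟨i, rfl⟩
    exact h i
  refine denseRange_ofFree.induction_on z hS fun w => ?_
  change w ∈ S.comap ofFree
  rw [h1]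
  exact Subgroup.mem_top w

theorem hom_eq_of_gen {H : Type*} [Group H] [TopologicalSpace H] [T2Space H] {f g : MHat →* H}
    (hf : Continuous f) (hg : Continuous g) (h : ∀ i, f (gen i) = g (gen i)) (z : MHat) :
    f z = g z :=
  mem_of_gen_mem (S := f.eqLocus g) (isClosed_eq hf hg) h z

open scoped commutatorElement in
theorem commutator_commutator (a b c d : MHat) : ⁅⁅a, b⁆, ⁅c, d⁆⁆ = 1 := by
  have hd := ProfiniteGrp.ProfiniteCompletion.denseRange (GrpCat.of FreeMetabelian)
  simp only [commutatorElement_def]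
  refine hd.induction_on a (isClosed_eq (by fun_prop) continuous_const) fun a => ?_
  refine hd.induction_on b (isClosed_eq (by fun_prop) continuous_const) fun b => ?_
  refine hd.induction_on c (isClosed_eq (by fun_prop) continuous_const) fun c => ?_
  refine hd.induction_on d (isClosed_eq (by fun_prop) continuous_const) fun d => ?_
  exact congrArg toMHat (FreeMetabelian.commutator_commutator a b c d)

open scoped commutatorElement in
/-- `M̂` is the free profinite metabelian group on its two generators. -/
theorem exists_hom {H : Type} [Group H] [TopologicalSpace H] [IsTopologicalGroup H]
    [CompactSpace H] [TotallyDisconnectedSpace H] (hH : ∀ a b c d : H, ⁅⁅a, b⁆, ⁅c, d⁆⁆ = 1)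
    (h : Fin 2 → H) : ∃ f : MHat →ₜ* H, ∀ i, f (gen i) = h i := by
  let φ : FreeMetabelian →* H := QuotientGroup.lift _ (FreeGroup.lift h) (fun w hw => by
    have := map_derivedSeries_le_derivedSeries (FreeGroup.lift h) 2 ⟨w, hw, rfl⟩
    rw [derivedSeries_two_eq_bot hH] at this
    exact this)
  let F : GrpCat.of FreeMetabelian ⟶ GrpCat.of (ProfiniteGrp.of H) := GrpCat.ofHom φ
  refine ⟨(ProfiniteGrp.ProfiniteCompletion.lift F).hom, fun i => ?_⟩
  have h1 := CategoryTheory.ConcreteCategory.congr_hom (ProfiniteGrp.ProfiniteCompletion.lift_eta F)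
    (QuotientGroup.mk (FreeGroup.of i) : FreeMetabelian)
  refine h1.trans ?_
  change FreeGroup.lift h (FreeGroup.of i) = h i
  rw [FreeGroup.lift_apply_of]

/-- The closed derived subgroup `M̂'`. -/
abbrev derived : Subgroup MHat := (commutator MHat).topologicalClosure

theorem isClosed_derived : IsClosed (derived : Set MHat) := Subgroup.isClosed_topologicalClosure _

open scoped commutatorElement in
theorem derived_mul_comm {u v : MHat} (hu : u ∈ derived) (hv : v ∈ derived) : u * v = v * u := by
  -- The abstract derived subgroup is abelian, hence so is its closure.
  have h0 : ∀ u ∈ commutator MHat, ∀ v ∈ commutator MHat, u * v = v * u := by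
    have h := derivedSeries_two_eq_bot commutator_commutator
    change ⁅commutator MHat, commutator MHat⁆ = ⊥ at h
    rw [eq_bot_iff, Subgroup.commutator_le] at h
    intro u hu v hv
    exact commutatorElement_eq_one_iff_mul_comm.1 (Subgroup.mem_bot.1 (h u hu v hv))
  have hcl : ∀ u : MHat, IsClosed {v : MHat | u * v = v * u} := fun u =>
    isClosed_eq (by fun_prop) (by fun_prop)
  have h1 : ∀ u ∈ commutator MHat, ∀ v ∈ derived, u * v = v * u := fun u hu v hv =>
    closure_minimal (h0 u hu) (hcl u) hv
  exact closure_minimal (fun w hw => (h1 w hw v hv).symm) (hcl v) hu |>.symm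

end MHat

/-! ### The profinite abelianization -/

instance : TotallyDisconnectedSpace AHat :=
  totallyDisconnectedSpace_quotient _ MHat.isClosed_derived

namespace AHat

/-- The projection `M̂ → Â`. -/
def mk : MHat →* AHat := QuotientGroup.mk' _

theorem continuous_mk : Continuous mk := QuotientGroup.continuous_mk

theorem mk_surjective : Function.Surjective mk := QuotientGroup.mk'_surjective _

theorem mk_eq_one_iff {z : MHat} : mk z = 1 ↔ z ∈ MHat.derived := QuotientGroup.eq_one_iff z

/-- The images in `Â` of the two free generators. -/
def gen (i : Fin 2) : AHat := mk (MHat.gen i)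

theorem hom_eq_of_gen {H : Type*} [Group H] [TopologicalSpace H] [T2Space H] {f g : AHat →* H}
    (hf : Continuous f) (hg : Continuous g) (h : ∀ i, f (gen i) = g (gen i)) (q : AHat) :
    f q = g q := by
  obtain ⟨z, rfl⟩ := mk_surjective q
  exact MHat.hom_eq_of_gen (f := f.comp mk) (g := g.comp mk) (hf.comp continuous_mk)
    (hg.comp continuous_mk) h z

theorem mem_of_gen_mem {S : Subgroup AHat} (hS : IsClosed (S : Set AHat)) (h : ∀ i, gen i ∈ S)
    (q : AHat) : q ∈ S := by
  obtain ⟨z, rfl⟩ := mk_surjective q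
  exact MHat.mem_of_gen_mem (S := S.comap mk) (hS.preimage continuous_mk) h z

/-- `Â` is the free profinite abelian group on its two generators. -/
theorem exists_hom {B : Type} [CommGroup B] [TopologicalSpace B] [IsTopologicalGroup B]
    [CompactSpace B] [TotallyDisconnectedSpace B] (h : Fin 2 → B) :
    ∃ f : AHat →ₜ* B, ∀ i, f (gen i) = h i := by
  obtain ⟨f, hf⟩ := MHat.exists_hom (fun a b c d : B => by
    rw [commutatorElement_eq_one_iff_mul_comm, mul_comm]) h
  have hle : MHat.derived ≤ (f : MHat →* B).ker := by
    refine Subgroup.topologicalClosure_minimal _ ?_ (isClosed_singleton.preimage f.continuous_toFun)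
    refine Subgroup.commutator_le.2 fun a _ b _ => ?_
    rw [MonoidHom.mem_ker, map_commutatorElement, commutatorElement_eq_one_iff_mul_comm, mul_comm]
  exact ⟨⟨QuotientGroup.lift _ (f : MHat →* B) hle, f.continuous_toFun.quotient_lift _⟩, hf⟩

end AHat

/-! ### Coordinates on the profinite abelianization -/

instance {X : Type*} [TopologicalSpace X] [T2Space X] : T2Space (Multiplicative X) :=
  inferInstanceAs (T2Space X)

instance : CompactSpace ZHat := by
  have h : IsClosed (zhatSubring : Set (∀ n : ℕ+, ZMod n)) := by
    change IsClosed {f : ∀ n : ℕ+, ZMod n | ∀ (m n : ℕ+) (h : (m : ℕ) ∣ (n : ℕ)),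
      ZMod.castHom h (ZMod m) (f n) = f m}
    simp only [Set.ofPred_forall]
    refine isClosed_iInter fun m => isClosed_iInter fun n => isClosed_iInter fun h => ?_
    exact isClosed_setOf_apply_eq (X := fun n : ℕ+ => ZMod n) (ZMod.castHom h (ZMod m))
  exact isCompact_iff_compactSpace.1 h.isCompact

/-- `Ẑ` is topologically generated by `1`; this follows from the density of the span of the group in
a completed group algebra, by means of the augmentation. -/
theorem ZHat.mem_of_one_mem {S : AddSubgroup ZHat} (hS : IsClosed (S : Set ZHat))
    (h : (1 : ZHat) ∈ S) (z : ZHat) : z ∈ S := by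
  have h1 := CompletedGroupAlgebra.mem_of_isClosed (Q := AHat)
    (S := S.comap (CompletedGroupAlgebra.augmentation (Q := AHat)).toAddMonoidHom)
    (hS.preimage CompletedGroupAlgebra.continuous_augmentation) (fun q => by
      change CompletedGroupAlgebra.augmentation (CompletedGroupAlgebra.of q) ∈ S
      rwa [CompletedGroupAlgebra.augmentation_of]) (CompletedGroupAlgebra.scalar z)
  change CompletedGroupAlgebra.augmentation (CompletedGroupAlgebra.scalar z) ∈ S at h1
  rwa [CompletedGroupAlgebra.augmentation_scalar] at h1

theorem ZHat.mem_of_single_mem {S : AddSubgroup (Fin 2 → ZHat)}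
    (hS : IsClosed (S : Set (Fin 2 → ZHat))) (h : ∀ i, Pi.single i 1 ∈ S) (v : Fin 2 → ZHat) :
    v ∈ S := by
  have h1 : ∀ i (z : ZHat), Pi.single i z ∈ S := fun i z =>
    ZHat.mem_of_one_mem (S := S.comap (AddMonoidHom.single (fun _ : Fin 2 => ZHat) i))
      (hS.preimage (continuous_single i)) (h i) z
  rw [← Finset.univ_sum_single v]
  exact S.sum_mem fun i _ => h1 i (v i)

/-- The powers of an element of a profinite abelian group with exponents in `Ẑ`. -/
theorem exists_zhatPow {B : Type*} [CommGroup B] [TopologicalSpace B] [IsTopologicalGroup B]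
    [CompactSpace B] [TotallyDisconnectedSpace B] (b : B) :
    ∃ F : Multiplicative ZHat →* B, Continuous F ∧ F (.ofAdd 1) = b := by
  obtain ⟨F, hF, hF'⟩ := CompletedGroupAlgebra.exists_lift (Q := AHat) (f := fun _ => b)
    continuous_const
  -- The lift of the constant function `b` sends the scalar `1 = of 1` to `b`.
  refine ⟨F.comp (AddMonoidHom.toMultiplicative
    (CompletedGroupAlgebra.scalar (Q := AHat)).toAddMonoidHom),
    hF.comp CompletedGroupAlgebra.continuous_scalar, ?_⟩
  change F (.ofAdd (CompletedGroupAlgebra.scalar 1)) = b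
  rw [map_one, ← hF' 1, map_one CompletedGroupAlgebra.of]

namespace AHat

theorem exists_coord : ∃ e : Multiplicative (Fin 2 → ZHat) ≃ₜ* AHat,
    ∀ i, e (.ofAdd (Pi.single i 1)) = gen i := by
  obtain ⟨χ, hχ⟩ := exists_hom (B := Multiplicative (Fin 2 → ZHat))
    (fun i => .ofAdd (Pi.single i 1))
  choose P hP hP' using fun i => exists_zhatPow (gen i)
  let E : Multiplicative (Fin 2 → ZHat) →* AHat :=
    { toFun := fun v => P 0 (.ofAdd (v.toAdd 0)) * P 1 (.ofAdd (v.toAdd 1))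
      map_one' := by simp
      map_mul' := fun v w => by
        rw [toAdd_mul, Pi.add_apply, Pi.add_apply, ofAdd_add, ofAdd_add, map_mul, map_mul]
        exact mul_mul_mul_comm _ _ _ _ }
  have hE : Continuous E := by
    have h0 : ∀ i, Continuous fun v : Multiplicative (Fin 2 → ZHat) => P i (.ofAdd (v.toAdd i)) :=
      fun i => (hP i).comp (continuous_apply (A := fun _ : Fin 2 => ZHat) i)
    exact (h0 0).mul (h0 1)
  have hEs : ∀ i, E (.ofAdd (Pi.single i 1)) = gen i := by
    intro i
    change P 0 (.ofAdd ((Pi.single i 1 : Fin 2 → ZHat) 0)) *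
      P 1 (.ofAdd ((Pi.single i 1 : Fin 2 → ZHat) 1)) = gen i
    fin_cases i
    · simp [hP']
    · simp [hP']
  have h1 : ∀ q, E (χ q) = q := fun q =>
    hom_eq_of_gen (f := E.comp (χ : AHat →* _)) (g := MonoidHom.id _) (hE.comp χ.continuous_toFun)
      continuous_id (fun i => by
        change E (χ (gen i)) = gen i
        rw [hχ, hEs]) q
  have h2 : ∀ v, χ (E v) = v := by
    intro v
    refine ZHat.mem_of_single_mem
      (S := Subgroup.toAddSubgroup'
        (((χ : AHat →* Multiplicative (Fin 2 → ZHat)).comp E).eqLocus (MonoidHom.id _)))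
      (isClosed_eq (χ.continuous_toFun.comp hE) continuous_id) (fun i => ?_) v.toAdd
    change χ (E (.ofAdd (Pi.single i 1))) = .ofAdd (Pi.single i 1)
    rw [hEs, hχ]
  exact ⟨{ E with
    invFun := χ
    left_inv := h2
    right_inv := h1
    continuous_toFun := hE
    continuous_invFun := χ.continuous_toFun }, hEs⟩

/-- Coordinates on `Â` in which the generators are the standard basis of `Ẑ²`. -/
def coord : Multiplicative (Fin 2 → ZHat) ≃ₜ* AHat := exists_coord.choose

theorem coord_single (i : Fin 2) : coord (.ofAdd (Pi.single i 1)) = gen i :=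
  exists_coord.choose_spec i

theorem coord_symm_gen (i : Fin 2) : coord.symm (gen i) = .ofAdd (Pi.single i 1) := by
  rw [← coord_single]
  exact coord.toEquiv.symm_apply_apply _

/-- Each generator has order divisible by any given `N` in a suitable finite quotient of `Â`. -/
theorem exists_openSubgroup_dvd (i : Fin 2) (N : ℕ+) :
    ∃ V : OpenSubgroup AHat, ∀ k : ℕ, gen i ^ k ∈ V → (N : ℕ) ∣ k := by
  obtain ⟨f, hf⟩ := exists_hom (B := Multiplicative (ZMod N)) (fun _ => .ofAdd 1)
  refine ⟨⟨(f : AHat →* Multiplicative (ZMod N)).ker,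
    (isOpen_discrete {1}).preimage f.continuous_toFun⟩, fun k hk => ?_⟩
  have h : f (gen i ^ k) = 1 := hk
  rw [map_pow, hf, ← ofAdd_nsmul, nsmul_one] at h
  exact (ZMod.natCast_eq_zero_iff k N).1 h

end AHat

/-! ### Regularity in the completed group algebra -/

/-- The fibres of `f` are unions of orbits of `g`, whose length vanishes in `ℤ/n`, so an element
invariant under `g` has image `0`. -/
theorem MonoidAlgebra.mapDomain_eq_zero_of_single_mul_eq {G H : Type*} [CommGroup G] [Finite G]
    [Group H] {n : ℕ} (f : G →* H) {g : G} (hg : f g = 1) (hn : n ∣ orderOf g)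
    {s : MonoidAlgebra (ZMod n) G} (hs : MonoidAlgebra.single g 1 * s = s) :
    MonoidAlgebra.mapDomain f s = 0 := by
  classical
  have := Fintype.ofFinite G
  let Z := Subgroup.zpowers g
  let π : G →* G ⧸ Z := QuotientGroup.mk' Z
  let f' : G ⧸ Z →* H := QuotientGroup.lift Z f (by
    intro z hz
    obtain ⟨k, rfl⟩ := Subgroup.mem_zpowers_iff.1 hz
    rw [MonoidHom.mem_ker, map_zpow, hg, one_zpow])
  have hinv : ∀ z ∈ Z, ∀ a, s.coeff (z * a) = s.coeff a := by
    let T : Subgroup G :=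
      { carrier := {z | ∀ a, s.coeff (z * a) = s.coeff a}
        mul_mem' := fun {x y} hx hy a => by rw [mul_assoc, hx, hy]
        one_mem' := fun a => by rw [one_mul]
        inv_mem' := fun {x} hx a => by rw [← hx (x⁻¹ * a), mul_inv_cancel_left] }
    have hT : Z ≤ T := by
      refine Subgroup.zpowers_le.2 fun a => ?_
      conv_lhs => rw [← hs]
      rw [MonoidAlgebra.coeff_single_mul_apply, one_mul, inv_mul_cancel_left]
    exact hT
  -- The fibres of `π` are single orbits of `g`, and `f` factors through `π`.
  have hπ : MonoidAlgebra.mapDomain π s = 0 := by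
    ext b
    obtain ⟨a, rfl⟩ := QuotientGroup.mk'_surjective Z b
    have h1 : (MonoidAlgebra.mapDomain π s).coeff (π a) =
        ∑ x ∈ Finset.univ.filter (fun x => π x = π a), s.coeff x := by
      rw [MonoidAlgebra.coeff_mapDomain, Finsupp.mapDomain, Finsupp.sum_apply,
        Finsupp.sum_fintype _ _ (by simp), Finset.sum_filter]
      exact Finset.sum_congr rfl fun x _ => Finsupp.single_apply
    have h2 : ∀ x ∈ Finset.univ.filter (fun x => π x = π a), s.coeff x = s.coeff a := by
      intro x hx
      have hx' : (a : G ⧸ Z) = x := (Finset.mem_filter.1 hx).2.symm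
      have := hinv _ (QuotientGroup.eq.1 hx') a
      rwa [inv_mul_eq_div, div_mul_cancel] at this
    have h3 : (Finset.univ.filter (fun x => π x = π a)).card = orderOf g := by
      rw [MonoidHom.card_fiber_eq_of_mem_range π ⟨a, rfl⟩ ⟨1, map_one π⟩, ← Nat.card_zpowers,
        Nat.card_eq_fintype_card, Fintype.card_subtype]
      congr 1
      ext x
      simp only [Finset.mem_filter, Finset.mem_univ, true_and]
      exact QuotientGroup.eq_one_iff x
    refine h1.trans ?_
    rw [Finset.sum_congr rfl h2, Finset.sum_const, h3, nsmul_eq_mul,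
      (ZMod.natCast_eq_zero_iff _ _).2 hn, zero_mul]
    rfl
  have hc : MonoidAlgebra.mapDomain f s =
      MonoidAlgebra.mapDomain f' (MonoidAlgebra.mapDomain π s) :=
    MonoidAlgebra.coeff_injective (Finsupp.mapDomain_comp (f := π) (g := f') (v := s.coeff))
  rw [hc, hπ, MonoidAlgebra.mapDomain_zero]

namespace CompletedGroupAlgebra

/-- `q - 1` is a nonzerodivisor if the order of `q` in the finite quotients is divisible by
arbitrary integers: an element of `(ℤ/n)[Q/V]` invariant under `q` has fibre sums over `Q/U`
divisible by `n`, for `V` small enough. -/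
theorem eq_zero_of_of_sub_one_mul_eq_zero {Q : Type} [CommGroup Q] [TopologicalSpace Q]
    [IsTopologicalGroup Q] [CompactSpace Q] {q : Q}
    (hq : ∀ N : ℕ+, ∃ V : OpenSubgroup Q, ∀ k : ℕ, q ^ k ∈ V → (N : ℕ) ∣ k)
    {r : CompletedGroupAlgebra Q} (hr : (of q - 1) * r = 0) : r = 0 := by
  have h1 : of q * r = r := by rwa [sub_mul, one_mul, sub_eq_zero] at hr
  have h2 : ∀ k : ℕ, of (q ^ k) * r = r := by
    intro k
    induction k with
    | zero => rw [pow_zero, map_one, one_mul]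
    | succ k ih => rw [pow_succ, map_mul, mul_assoc, h1, ih]
  refine ext_proj fun n U => ?_
  rw [map_zero]
  have : Finite (Q ⧸ U.toSubgroup) := U.toSubgroup.quotient_finite_of_isOpen U.isOpen
  let o : ℕ+ := ⟨orderOf (QuotientGroup.mk q : Q ⧸ U.toSubgroup), orderOf_pos _⟩
  have ho : q ^ (o : ℕ) ∈ U.toSubgroup :=
    (QuotientGroup.eq_one_iff _).1 (pow_orderOf_eq_one (QuotientGroup.mk q : Q ⧸ U.toSubgroup))
  -- In `Q/W` the order of `q ^ o`, which is trivial in `Q/U`, will be a multiple of `n`.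
  obtain ⟨V, hV⟩ := hq (n * o)
  let W := U ⊓ V
  have : Finite (Q ⧸ W.toSubgroup) := W.toSubgroup.quotient_finite_of_isOpen W.isOpen
  have hWU : W ≤ U := inf_le_left
  let f := QuotientGroup.map W.toSubgroup U.toSubgroup (MonoidHom.id Q) hWU
  have key : MonoidAlgebra.mapDomain f (proj n W r) = 0 := by
    refine MonoidAlgebra.mapDomain_eq_zero_of_single_mul_eq f
      (g := QuotientGroup.mk (q ^ (o : ℕ))) ((QuotientGroup.eq_one_iff _).2 ho) ?_ ?_
    · have h3 := pow_orderOf_eq_one (QuotientGroup.mk (q ^ (o : ℕ)) : Q ⧸ W.toSubgroup)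
      rw [← QuotientGroup.mk_pow, QuotientGroup.eq_one_iff, ← pow_mul] at h3
      have h4 := hV _ h3.2
      rw [PNat.mul_coe, mul_comm (n : ℕ)] at h4
      exact Nat.dvd_of_mul_dvd_mul_left o.pos h4
    · rw [← proj_of, ← map_mul, h2]
  rw [← transition_proj r (dvd_refl (n : ℕ)) hWU]
  change MonoidAlgebra.mapRingHom _ _ (MonoidAlgebra.mapDomain f (proj n W r)) = 0
  rw [key, map_zero]

theorem isClosed_span_pair {Q : Type} [CommGroup Q] [TopologicalSpace Q] [IsTopologicalGroup Q]
    [CompactSpace Q] (a b : CompletedGroupAlgebra Q) :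
    IsClosed (Ideal.span {a, b} : Set (CompletedGroupAlgebra Q)) := by
  have h : (Ideal.span {a, b} : Set (CompletedGroupAlgebra Q)) =
      Set.range fun p : CompletedGroupAlgebra Q × CompletedGroupAlgebra Q =>
        p.1 * a + p.2 * b := by
    ext r
    rw [SetLike.mem_coe, Ideal.mem_span_pair]
    exact ⟨fun ⟨s, t, h⟩ => ⟨(s, t), h⟩, fun ⟨p, h⟩ => ⟨p.1, p.2, h⟩⟩
  rw [h]
  have hc : Continuous fun p : CompletedGroupAlgebra Q × CompletedGroupAlgebra Q =>
      p.1 * a + p.2 * b :=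
    (continuous_fst.mul continuous_const).add (continuous_snd.mul continuous_const)
  exact (isCompact_range hc).isClosed

/-- Two continuous endomorphisms of `Â` that agree on the generators modulo a closed ideal `I`
induce the same map modulo `I`. -/
theorem map_sub_map_mem {I : Ideal (CompletedGroupAlgebra AHat)}
    (hI : IsClosed (I : Set (CompletedGroupAlgebra AHat))) {φ ψ : AHat →ₜ* AHat}
    (h : ∀ i, of (φ (AHat.gen i)) - of (ψ (AHat.gen i)) ∈ I) (r : CompletedGroupAlgebra AHat) :
    map φ r - map ψ r ∈ I := by
  let T : Subgroup AHat :=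
    { carrier := {q | of (φ q) - of (ψ q) ∈ I}
      mul_mem' := fun {a b} ha hb => by
        change of (φ (a * b)) - of (ψ (a * b)) ∈ I
        have : of (φ (a * b)) - of (ψ (a * b)) =
            of (φ a) * (of (φ b) - of (ψ b)) + of (ψ b) * (of (φ a) - of (ψ a)) := by
          simp only [map_mul]
          ring
        rw [this]
        exact I.add_mem (I.mul_mem_left _ hb) (I.mul_mem_left _ ha)
      one_mem' := by
        change of (φ 1) - of (ψ 1) ∈ I
        rw [map_one φ, map_one ψ, sub_self]
        exact I.zero_mem
      inv_mem' := fun {a} ha => by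
        change of (φ a⁻¹) - of (ψ a⁻¹) ∈ I
        have h1 : of (φ a⁻¹) * of (φ a) = 1 := by rw [← map_mul, ← map_mul]; simp
        have h2 : of (ψ a⁻¹) * of (ψ a) = 1 := by rw [← map_mul, ← map_mul]; simp
        have : of (φ a⁻¹) - of (ψ a⁻¹) =
            -(of (φ a⁻¹) * of (ψ a⁻¹)) * (of (φ a) - of (ψ a)) := by
          linear_combination of (ψ a⁻¹) * h1 - of (φ a⁻¹) * h2
        rw [this]
        exact I.mul_mem_left _ ha }
  have hT : IsClosed (T : Set AHat) :=
    hI.preimage ((continuous_of.comp φ.continuous_toFun).sub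
      (continuous_of.comp ψ.continuous_toFun))
  refine mem_of_isClosed (S := I.toAddSubgroup.comap
    ((map φ).toAddMonoidHom - (map ψ).toAddMonoidHom)) ?_ (fun q => ?_) r
  · exact hI.preimage ((continuous_map φ).sub (continuous_map ψ))
  · change map φ (of q) - map ψ (of q) ∈ I
    rw [map_of, map_of]
    exact AHat.mem_of_gen_mem hT h q

/-- The trivial endomorphism of `Â` induces the augmentation. -/
theorem map_trivial (r : CompletedGroupAlgebra AHat) :
    map (1 : AHat →ₜ* AHat) r = scalar (augmentation r) := by
  have h := mem_of_isClosed (S := ((map (1 : AHat →ₜ* AHat)).toAddMonoidHom -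
    ((scalar (Q := AHat)).comp augmentation).toAddMonoidHom).ker)
    (isClosed_singleton.preimage ((continuous_map _).sub
      (continuous_scalar.comp continuous_augmentation))) (fun q => by
        change map (1 : AHat →ₜ* AHat) (of q) - scalar (augmentation (of q)) = 0
        rw [map_of, augmentation_of, map_one, sub_eq_zero]
        exact map_one of) r
  exact sub_eq_zero.1 h

/-- For every automorphism `g` of `Â`, the augmentation ideal is generated by the elements
`g x - 1` and `g y - 1`. -/
theorem mem_span_of_augmentation_eq (g : ContAut AHat) {r s : CompletedGroupAlgebra AHat}
    (h : augmentation r = augmentation s) :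
    r - s ∈ Ideal.span {of (g (AHat.gen 0)) - 1, of (g (AHat.gen 1)) - 1} := by
  set I := Ideal.span {of (g (AHat.gen 0)) - 1, of (g (AHat.gen 1)) - 1} with hI
  -- Compare `g` with the trivial endomorphism.
  have key : ∀ t, t - scalar (augmentation t) ∈ I := by
    intro t
    have h1 := map_sub_map_mem (I := I) (isClosed_span_pair _ _) (φ := g.toHom) (ψ := 1)
      (fun i => by
        change of (g (AHat.gen i)) - of 1 ∈ I
        rw [map_one]
        fin_cases i
        · exact Ideal.subset_span (Or.inl rfl)
        · exact Ideal.subset_span (Or.inr rfl)) (map (g⁻¹).toHom t)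
    rw [map_trivial, augmentation_map, ← map_comp] at h1
    have h2 : g.toHom.comp (g⁻¹).toHom = ContinuousMonoidHom.id AHat :=
      ContinuousMonoidHom.ext fun q => ContAut.apply_inv_self _ g q
    rwa [h2, map_id] at h1
  have := I.sub_mem (key r) (key s)
  rw [h] at this
  convert this using 1
  ring

theorem eq_zero_of_gen_sub_one_mul_eq_zero (i : Fin 2) {r : CompletedGroupAlgebra AHat}
    (hr : (of (AHat.gen i) - 1) * r = 0) : r = 0 :=
  eq_zero_of_of_sub_one_mul_eq_zero (AHat.exists_openSubgroup_dvd i) hr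

/-- Exactness of the Koszul complex of `x - 1, y - 1`. Reduction modulo `x - 1` is realized inside
`Ẑ⟦Â⟧` as the endomorphism induced by the retraction of `Â` that kills `x`. -/
theorem exists_koszul {a b : CompletedGroupAlgebra AHat}
    (h : (of (AHat.gen 0) - 1) * b = (of (AHat.gen 1) - 1) * a) :
    ∃ t, a = (of (AHat.gen 0) - 1) * t ∧ b = (of (AHat.gen 1) - 1) * t := by
  -- the retraction `p` of `Â` with `p x = 1` and `p y = y`
  obtain ⟨p, hp⟩ := AHat.exists_hom ![1, AHat.gen 1]
  have hp0 : p (AHat.gen 0) = 1 := hp 0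
  have hp1 : p (AHat.gen 1) = AHat.gen 1 := hp 1
  have h1 : (of (AHat.gen 1) - 1) * map p a = 0 := by
    have := congrArg (map p) h
    rw [map_mul, map_mul, map_sub, map_sub, map_of, map_of, hp0, hp1] at this
    simpa using this.symm
  have h2 := eq_zero_of_gen_sub_one_mul_eq_zero 1 h1
  have h3 := map_sub_map_mem (I := Ideal.span {of (AHat.gen 0) - 1, 0}) (isClosed_span_pair _ _)
    (φ := ContinuousMonoidHom.id AHat) (ψ := p) (fun i => by
      change of (AHat.gen i) - of (p (AHat.gen i)) ∈ _
      fin_cases i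
      · refine Ideal.subset_span (Or.inl ?_)
        change of (AHat.gen 0) - of (p (AHat.gen 0)) = _
        rw [hp0, map_one]
      · change of (AHat.gen 1) - of (p (AHat.gen 1)) ∈ _
        rw [hp1, sub_self]
        exact Ideal.zero_mem _) a
  rw [map_id, h2, sub_zero, Ideal.mem_span_pair] at h3
  obtain ⟨t, u, ht⟩ := h3
  have ha : a = (of (AHat.gen 0) - 1) * t := by rw [← ht]; ring
  refine ⟨t, ha, sub_eq_zero.1 (eq_zero_of_gen_sub_one_mul_eq_zero 0 ?_)⟩
  rw [ha] at h
  linear_combination h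

end CompletedGroupAlgebra

/-! ### The derived subgroup as a module over the completed group algebra -/

namespace MHat

open CompletedGroupAlgebra
open scoped commutatorElement

/-- The ring `Ẑ⟦Â⟧`. -/
abbrev R : Type := CompletedGroupAlgebra AHat

/-- Conjugates of `m` by `M̂` depend only on the class of the conjugating element in `Â`, as `M̂'`
is abelian, so they extend to `Ẑ⟦Â⟧` by freeness. -/
theorem exists_orbitMap (m : derived) : ∃ F : Multiplicative R →* MHat, Continuous F ∧
    (∀ z, F (.ofAdd (of (AHat.mk z))) = z * m * z⁻¹) ∧ ∀ r, F r ∈ derived := by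
  let _ : CommGroup derived :=
    { (inferInstance : Group derived) with
      mul_comm := fun u v => Subtype.ext (derived_mul_comm u.2 v.2) }
  have : CompactSpace derived := isCompact_iff_compactSpace.1 isClosed_derived.isCompact
  have : IsTopologicalGroup derived := Subgroup.instIsTopologicalGroupSubtypeMem derived
  let f₀ : MHat → derived := fun z =>
    ⟨z * m * z⁻¹, (instNormalCommutatorClosure _).conj_mem _ m.2 z⟩
  have hf₀ : Continuous f₀ := by
    refine Continuous.subtype_mk ?_ _
    fun_prop
  let f : AHat → derived := fun q => Quotient.liftOn' q f₀ (fun a b hab => by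
    have h1 := QuotientGroup.leftRel_apply.1 hab
    refine Subtype.ext ?_
    change a * m * a⁻¹ = b * m * b⁻¹
    have h2 := derived_mul_comm h1 m.2
    calc a * m * a⁻¹ = a * (m * (a⁻¹ * b)) * b⁻¹ := by group
      _ = a * (a⁻¹ * b * m) * b⁻¹ := by rw [h2]
      _ = b * m * b⁻¹ := by group)
  have hf : Continuous f := hf₀.quotient_lift _
  obtain ⟨F, hF, hF'⟩ := exists_lift hf
  exact ⟨derived.subtype.comp F, continuous_subtype_val.comp hF,
    fun z => congrArg Subtype.val (hF' (AHat.mk z)), fun r => (F r).2⟩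

/-- The orbit map `r ↦ m ^ r` of an element `m` of `M̂'`. -/
def orbitMap (m : derived) : Multiplicative R →* MHat := (exists_orbitMap m).choose

/-- The action `m ^ r` of `r : Ẑ⟦Â⟧` on `m : M̂'`. -/
def dpow (m : derived) (r : R) : MHat := orbitMap m (.ofAdd r)

variable (m : derived)

theorem continuous_dpow : Continuous (dpow m) := (exists_orbitMap m).choose_spec.1

theorem dpow_of (z : MHat) : dpow m (of (AHat.mk z)) = z * m * z⁻¹ :=
  (exists_orbitMap m).choose_spec.2.1 z

theorem dpow_mem (r : R) : dpow m r ∈ derived := (exists_orbitMap m).choose_spec.2.2 _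

theorem mk_dpow (r : R) : AHat.mk (dpow m r) = 1 := AHat.mk_eq_one_iff.2 (dpow_mem m r)

theorem dpow_add (r s : R) : dpow m (r + s) = dpow m r * dpow m s := (orbitMap m).map_mul _ _

theorem dpow_zero : dpow m 0 = 1 := (orbitMap m).map_one

theorem dpow_neg (r : R) : dpow m (-r) = (dpow m r)⁻¹ := (orbitMap m).map_inv _

theorem dpow_one : dpow m 1 = m := by
  have := dpow_of m 1
  rwa [map_one, map_one, one_mul, inv_one, mul_one] at this

variable {m} in
/-- The two defining properties of the orbit map determine it. -/
theorem orbitMap_eq {F : Multiplicative R →* MHat} (hF : Continuous F)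
    (h : ∀ z : MHat, F (.ofAdd (of (AHat.mk z))) = z * m * z⁻¹) : F = orbitMap m :=
  monoidHom_ext hF (continuous_dpow m) fun q => by
    obtain ⟨z, rfl⟩ := AHat.mk_surjective q
    exact (h z).trans (dpow_of m z).symm

theorem isPow_iff {r : R} {d : MHat} : IsPow (m : MHat) r d ↔ dpow m r = d := by
  constructor
  · rintro ⟨F, hF, hF', rfl⟩
    rw [orbitMap_eq hF hF']
    rfl
  · intro h
    exact ⟨orbitMap m, continuous_dpow m, dpow_of m, h⟩

theorem conj_dpow (z : MHat) (r : R) : z * dpow m r * z⁻¹ = dpow m (of (AHat.mk z) * r) := by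
  have h := monoidHom_ext (f := (MulAut.conj z).toMonoidHom.comp (orbitMap m))
    (g := (orbitMap m).comp (AddMonoidHom.toMultiplicative (AddMonoidHom.mulLeft (of (AHat.mk z)))))
    (by
      have := continuous_dpow m
      change Continuous fun r => z * dpow m r * z⁻¹
      fun_prop)
    ((continuous_dpow m).comp (continuous_const.mul continuous_id)) (fun q => by
      obtain ⟨w, rfl⟩ := AHat.mk_surjective q
      change z * dpow m (of (AHat.mk w)) * z⁻¹ = dpow m (of (AHat.mk z) * of (AHat.mk w))
      rw [← map_mul, ← map_mul, dpow_of, dpow_of]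
      group)
  exact DFunLike.congr_fun h (.ofAdd r)

/-- A continuous endomorphism of `M̂` is semilinear over the map it induces on `Ẑ⟦Â⟧`. -/
theorem map_dpow {φ : MHat →* MHat} (hφ : Continuous φ) {g : AHat →ₜ* AHat}
    (hg : ∀ z, AHat.mk (φ z) = g (AHat.mk z)) {m' : derived} (hm : φ m = m') (r : R) :
    φ (dpow m r) = dpow m' (map g r) := by
  have h := monoidHom_ext (f := φ.comp (orbitMap m))
    (g := (orbitMap m').comp (AddMonoidHom.toMultiplicative (map g).toAddMonoidHom))
    (hφ.comp (continuous_dpow m)) ((continuous_dpow m').comp (continuous_map g)) (fun q => by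
      obtain ⟨w, rfl⟩ := AHat.mk_surjective q
      change φ (dpow m (of (AHat.mk w))) = dpow m' (map g (of (AHat.mk w)))
      rw [map_of, ← hg, dpow_of, dpow_of, map_mul, map_mul, map_inv, hm])
  exact DFunLike.congr_fun h (.ofAdd r)

theorem dpow_dpow {m' : derived} {s : R} (hm : dpow m s = m') (r : R) :
    dpow m' r = dpow m (r * s) := by
  have h := monoidHom_ext (f := orbitMap m')
    (g := (orbitMap m).comp (AddMonoidHom.toMultiplicative (AddMonoidHom.mulRight s)))
    (continuous_dpow m') ((continuous_dpow m).comp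
      (continuous_id.mul continuous_const : Continuous fun r : R => r * s))
    (fun q => by
      obtain ⟨w, rfl⟩ := AHat.mk_surjective q
      change dpow m' (of (AHat.mk w)) = dpow m (of (AHat.mk w) * s)
      rw [← conj_dpow, dpow_of, hm])
  exact DFunLike.congr_fun h (.ofAdd r)

theorem commutatorElement_mem_derived (X Y : MHat) : ⁅X, Y⁆ ∈ derived :=
  Subgroup.le_topologicalClosure _
    (Subgroup.commutator_mem_commutator (Subgroup.mem_top X) (Subgroup.mem_top Y))

/-- The effect on the commutator of a pair `X, Y` of changing it by elements of `M̂'`. -/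
theorem commutator_mul_dpow {X Y : MHat} {u : R} (h : ⁅X, Y⁆ = dpow m u) (a b : R) :
    ⁅X * dpow m a, Y * dpow m b⁆ = dpow m (u + of (AHat.mk X) * (1 - of (AHat.mk Y)) * a +
      of (AHat.mk Y) * (of (AHat.mk X) - 1) * b) := by
  have h1 : ⁅X * dpow m a, Y * dpow m b⁆ = (X * dpow m a * X⁻¹) *
      ((X * Y) * (dpow m b * (dpow m a)⁻¹) * (X * Y)⁻¹) * ⁅X, Y⁆ *
        (Y * (dpow m b)⁻¹ * Y⁻¹) := by
    simp only [commutatorElement_def]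
    group
  rw [h1, h, ← dpow_neg, ← dpow_neg, ← dpow_add, conj_dpow, conj_dpow, conj_dpow, ← dpow_add,
    ← dpow_add, ← dpow_add, map_mul, map_mul]
  congr 1
  ring

/-! ### Freeness of the derived subgroup -/

/-- The group `Ẑ⟦Â⟧ ⋊ Â` of affine maps `r ↦ q r + a` of `Ẑ⟦Â⟧`, as pairs `(a, q)`. -/
def AffineGroup : Type := R × AHat

namespace AffineGroup

instance : TopologicalSpace AffineGroup := inferInstanceAs (TopologicalSpace (R × AHat))
instance : CompactSpace AffineGroup := inferInstanceAs (CompactSpace (R × AHat))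
instance : TotallyDisconnectedSpace AffineGroup :=
  inferInstanceAs (TotallyDisconnectedSpace (R × AHat))

instance : Group AffineGroup where
  mul f g := (f.1 + of f.2 * g.1, f.2 * g.2)
  one := (0, 1)
  inv f := (-(of f.2⁻¹ * f.1), f.2⁻¹)
  mul_assoc f g h := Prod.ext (by
    change f.1 + of f.2 * g.1 + of (f.2 * g.2) * h.1 = f.1 + of f.2 * (g.1 + of g.2 * h.1)
    rw [map_mul]
    ring) (mul_assoc _ _ _)
  one_mul f := Prod.ext (by
    change 0 + of 1 * f.1 = f.1
    rw [map_one, one_mul, zero_add]) (one_mul _)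
  mul_one f := Prod.ext (by
    change f.1 + of f.2 * 0 = f.1
    rw [mul_zero, add_zero]) (mul_one _)
  inv_mul_cancel f := Prod.ext (neg_add_cancel _) (inv_mul_cancel f.2)

/-- The affine map `r ↦ q r + a`. -/
def mk (a : R) (q : AHat) : AffineGroup := (a, q)

theorem mul_def (f g : AffineGroup) : f * g = mk (f.1 + of f.2 * g.1) (f.2 * g.2) := rfl

theorem inv_def (f : AffineGroup) : f⁻¹ = mk (-(of f.2⁻¹ * f.1)) f.2⁻¹ := rfl

instance : IsTopologicalGroup AffineGroup where
  continuous_mul := by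
    have h1 : Continuous fun p : (R × AHat) × (R × AHat) => of p.1.2 :=
      continuous_of.comp (continuous_snd.comp continuous_fst)
    exact ((continuous_fst.comp continuous_fst).add
      (h1.mul (continuous_fst.comp continuous_snd))).prodMk
        ((continuous_snd.comp continuous_fst).mul (continuous_snd.comp continuous_snd))
  continuous_inv := by
    have h1 : Continuous fun p : R × AHat => of p.2⁻¹ :=
      continuous_of.comp continuous_snd.inv
    exact (h1.mul continuous_fst).neg.prodMk continuous_snd.inv

/-- The linear part of an affine map. -/
def linear : AffineGroup →* AHat where
  toFun f := f.2
  map_one' := rfl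
  map_mul' _ _ := rfl

theorem continuous_linear : Continuous linear := continuous_snd

theorem commutator_commutator (a b c d : AffineGroup) : ⁅⁅a, b⁆, ⁅c, d⁆⁆ = 1 := by
  have h : ∀ a b : AffineGroup, (⁅a, b⁆ : AffineGroup).2 = 1 := fun a b => by
    change linear ⁅a, b⁆ = 1
    rw [map_commutatorElement, commutatorElement_eq_one_iff_mul_comm, mul_comm]
  rw [commutatorElement_eq_one_iff_mul_comm, mul_def, mul_def, h, h, map_one, one_mul, one_mul,
    one_mul, add_comm]

/-- The translations, scaled by `s`. -/
def translation (s : R) : Multiplicative R →* AffineGroup where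
  toFun r := (r.toAdd * s, 1)
  map_one' := Prod.ext (zero_mul s) rfl
  map_mul' r t := Prod.ext (by
    change (r.toAdd + t.toAdd) * s = r.toAdd * s + of 1 * (t.toAdd * s)
    rw [map_one, one_mul, add_mul]) (one_mul 1).symm

theorem continuous_translation (s : R) : Continuous (translation s) :=
  ((continuous_id.mul continuous_const : Continuous fun r : R => r * s).prodMk continuous_const)

end AffineGroup

/-- The commutator of the two generators. -/
def genCommutator : derived := ⟨⁅gen 0, gen 1⁆, commutatorElement_mem_derived _ _⟩

/-- `m` is a basis of the `Ẑ⟦Â⟧`-module `M̂'`: every element of `M̂'` is `m ^ r` for a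
unique `r`. -/
structure IsBasis (m : derived) : Prop where
  injective : Function.Injective (dpow m)
  surjective : ∀ z ∈ derived, ∃ r, dpow m r = z

theorem isClosed_range_dpow : IsClosed (Set.range (dpow m)) :=
  (isCompact_range (continuous_dpow m)).isClosed

variable {m} in
/-- A closed normal subgroup containing the commutator of the generators contains `M̂'`. -/
theorem derived_le {L : Subgroup MHat} [hn : L.Normal] (hL : IsClosed (L : Set MHat))
    (h : ⁅gen 0, gen 1⁆ ∈ L) : derived ≤ L := by
  have hmem : ∀ X Y : MHat, ⁅X, Y⁆ ∈ L ↔ (X : MHat ⧸ L) * Y = Y * X := fun X Y => by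
    rw [← QuotientGroup.eq_one_iff, ← commutatorElement_eq_one_iff_mul_comm]
    rfl
  let C : MHat → Subgroup MHat := fun Y =>
    (Subgroup.centralizer {(Y : MHat ⧸ L)}).comap (QuotientGroup.mk' L)
  have hC : ∀ X Y, X ∈ C Y ↔ ⁅X, Y⁆ ∈ L := fun X Y => by
    rw [hmem, Subgroup.mem_comap, Subgroup.mem_centralizer_singleton_iff]
    rfl
  have hCc : ∀ Y, IsClosed (C Y : Set MHat) := fun Y => by
    have : (C Y : Set MHat) = (fun X => X * Y * X⁻¹ * Y⁻¹) ⁻¹' L := Set.ext fun X => hC X Y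
    rw [this]
    exact hL.preimage (by fun_prop)
  have hsymm : ∀ X Y, ⁅X, Y⁆ ∈ L → ⁅Y, X⁆ ∈ L := fun X Y hXY =>
    (hmem Y X).2 ((hmem X Y).1 hXY).symm
  have hself : ∀ X : MHat, ⁅X, X⁆ ∈ L := fun X => (hmem X X).2 rfl
  have hgen : ∀ i j, ⁅gen i, gen j⁆ ∈ L := by
    intro i j
    fin_cases i <;> fin_cases j
    · exact hself _
    · exact h
    · exact hsymm _ _ h
    · exact hself _
  have h1 : ∀ X j, ⁅X, gen j⁆ ∈ L := fun X j =>
    (hC _ _).1 (mem_of_gen_mem (hCc _) (fun i => (hC _ _).2 (hgen i j)) X)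
  have h2 : ∀ X Y, ⁅Y, X⁆ ∈ L := fun X Y =>
    (hC _ _).1 (mem_of_gen_mem (hCc _) (fun i => (hC _ _).2 (hsymm _ _ (h1 X i))) Y)
  exact Subgroup.topologicalClosure_minimal _ (Subgroup.commutator_le.2 fun a _ b _ => h2 b a) hL

/-- The submodule of `M̂'` generated by `m`, as a subgroup of `M̂`. -/
def orbitRange : Subgroup MHat := (orbitMap m).range

instance : (orbitRange m).Normal where
  conj_mem := by
    rintro _ ⟨r, rfl⟩ z
    exact ⟨.ofAdd (of (AHat.mk z) * r.toAdd), (conj_dpow m z r.toAdd).symm⟩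

theorem isClosed_orbitRange : IsClosed (orbitRange m : Set MHat) := isClosed_range_dpow m

theorem mem_orbitRange {z : MHat} : z ∈ orbitRange m ↔ ∃ r, dpow m r = z := Iff.rfl

/-- `M̂'` is free on the commutator of the generators. Injectivity is seen in the affine group,
where the commutator of `(0, x)` and `(1, y)` is the translation by the nonzerodivisor `x - 1`. -/
theorem isBasis_genCommutator : IsBasis genCommutator := by
  constructor
  · obtain ⟨D, hD⟩ := exists_hom AffineGroup.commutator_commutator
      ![AffineGroup.mk 0 (AHat.gen 0), AffineGroup.mk 1 (AHat.gen 1)]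
    have hD0 : D (gen 0) = AffineGroup.mk 0 (AHat.gen 0) := hD 0
    have hD1 : D (gen 1) = AffineGroup.mk 1 (AHat.gen 1) := hD 1
    have hlin : ∀ z, (D z).2 = AHat.mk z := fun z =>
      hom_eq_of_gen (f := AffineGroup.linear.comp (D : MHat →* AffineGroup)) (g := AHat.mk)
        (AffineGroup.continuous_linear.comp D.continuous_toFun) AHat.continuous_mk (fun i => by
          change (D (gen i)).2 = AHat.gen i
          fin_cases i
          · exact congrArg Prod.snd hD0
          · exact congrArg Prod.snd hD1) z
    have hc : D ⁅gen 0, gen 1⁆ = AffineGroup.translation (of (AHat.gen 0) - 1) (.ofAdd 1) := by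
      rw [map_commutatorElement, hD0, hD1, commutatorElement_def]
      simp only [AffineGroup.mul_def, AffineGroup.inv_def]
      refine Prod.ext ?_ ?_
      · change 0 + of (AHat.gen 0) * 1 + of (AHat.gen 0 * AHat.gen 1) *
          (-(of (AHat.gen 0)⁻¹ * 0)) + of (AHat.gen 0 * AHat.gen 1 * (AHat.gen 0)⁻¹) *
            (-(of (AHat.gen 1)⁻¹ * 1)) = 1 * (of (AHat.gen 0) - 1)
        have h1 : of (AHat.gen 0 * AHat.gen 1 * (AHat.gen 0)⁻¹) * of (AHat.gen 1)⁻¹ = 1 := by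
          rw [← map_mul, mul_comm (AHat.gen 0), mul_inv_cancel_right, mul_inv_cancel, map_one]
        linear_combination -h1
      · change AHat.gen 0 * AHat.gen 1 * (AHat.gen 0)⁻¹ * (AHat.gen 1)⁻¹ = 1
        rw [mul_comm (AHat.gen 0), mul_inv_cancel_right, mul_inv_cancel]
    have key : ∀ r, D (dpow genCommutator r) =
        AffineGroup.translation (of (AHat.gen 0) - 1) (.ofAdd r) := by
      intro r
      have h := monoidHom_ext (f := (D : MHat →* AffineGroup).comp (orbitMap genCommutator))
        (g := AffineGroup.translation (of (AHat.gen 0) - 1))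
        (D.continuous_toFun.comp (continuous_dpow _)) (AffineGroup.continuous_translation _)
        (fun q => by
          obtain ⟨w, rfl⟩ := AHat.mk_surjective q
          change D (dpow genCommutator (of (AHat.mk w))) = _
          rw [dpow_of, map_mul, map_mul, map_inv]
          change D w * D ⁅gen 0, gen 1⁆ * (D w)⁻¹ = _
          rw [hc, ← hlin]
          refine mul_inv_eq_of_eq_mul ?_
          refine Prod.ext ?_ ((mul_one _).trans (one_mul _).symm)
          change (D w).1 + of (D w).2 * (1 * (of (AHat.gen 0) - 1)) =
            of (D w).2 * (of (AHat.gen 0) - 1) + of 1 * (D w).1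
          rw [map_one]
          ring)
      exact DFunLike.congr_fun h (.ofAdd r)
    intro r s hrs
    have h1 := congrArg D hrs
    rw [key, key] at h1
    have h2 : r * (of (AHat.gen 0) - 1) = s * (of (AHat.gen 0) - 1) := congrArg Prod.fst h1
    refine sub_eq_zero.1 (eq_zero_of_gen_sub_one_mul_eq_zero 0 ?_)
    linear_combination h2
  · intro z hz
    exact derived_le (isClosed_orbitRange genCommutator)
      ((mem_orbitRange _).2 ⟨1, dpow_one genCommutator⟩) hz

variable {m} in
/-- An element generating the free module `M̂'` of rank one is a basis. -/
theorem isBasis_of_mem_orbitRange (h : ⁅gen 0, gen 1⁆ ∈ orbitRange m) : IsBasis m := by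
  refine ⟨fun r s hrs => ?_, fun z hz => derived_le (isClosed_orbitRange m) h hz⟩
  obtain ⟨w, hw⟩ := (mem_orbitRange m).1 h
  obtain ⟨v, hv⟩ := isBasis_genCommutator.surjective m m.2
  have h1 := dpow_dpow genCommutator hv
  have hwv : w * v = 1 := isBasis_genCommutator.injective (by
    rw [← h1, hw, dpow_one]
    rfl)
  rw [h1, h1] at hrs
  have h2 := isBasis_genCommutator.injective hrs
  linear_combination w * h2 - (r - s) * hwv

end MHat

theorem toMHat_mul (a b : FreeMetabelian) : toMHat (a * b) = toMHat a * toMHat b := rfl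

/-- The canonical homomorphism `M → M̂`. -/
def toMHatHom : FreeMetabelian →* MHat where
  toFun := toMHat
  map_one' := rfl
  map_mul' := toMHat_mul

theorem IsDerivedBasis.toMHat_mem_derived {c : FreeMetabelian} (hc : IsDerivedBasis c) :
    toMHat c ∈ MHat.derived := by
  have h1 : c ∈ commutator FreeMetabelian := by
    rw [← show Subgroup.normalClosure {c} = commutator FreeMetabelian from hc]
    exact Subgroup.subset_normalClosure rfl
  have h2 : (commutator FreeMetabelian).map toMHatHom ≤ commutator MHat := by
    rw [commutator_def, Subgroup.map_commutator]
    exact Subgroup.commutator_mono le_top le_top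
  exact Subgroup.le_topologicalClosure _ (h2 ⟨c, h1, rfl⟩)

open scoped commutatorElement in
/-- A basis of `M'` is a basis of `M̂'`. -/
theorem IsDerivedBasis.isBasis {c : FreeMetabelian} (hc : IsDerivedBasis c) :
    MHat.IsBasis ⟨toMHat c, hc.toMHat_mem_derived⟩ := by
  refine MHat.isBasis_of_mem_orbitRange ?_
  set m : MHat.derived := ⟨toMHat c, hc.toMHat_mem_derived⟩
  have h1 : Subgroup.normalClosure {c} ≤ (MHat.orbitRange m).comap toMHatHom := by
    refine Subgroup.normalClosure_le_normal ?_
    rintro _ rfl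
    exact (MHat.mem_orbitRange m).2 ⟨1, MHat.dpow_one m⟩
  rw [show Subgroup.normalClosure {c} = commutator FreeMetabelian from hc] at h1
  exact h1 (Subgroup.commutator_mem_commutator
    (Subgroup.mem_top (QuotientGroup.mk (FreeGroup.of 0)))
    (Subgroup.mem_top (QuotientGroup.mk (FreeGroup.of 1))))

/-! ### Generalized Bachmuth determinants -/

theorem autAb_innerAut {G : Type} [Group G] [TopologicalSpace G] [IsTopologicalGroup G] (g : G) :
    autAb G (innerAut G g) = 1 := by
  have h : (QuotientGroup.mk (innerAut G g) : Out G) = 1 :=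
    (QuotientGroup.eq_one_iff _).2 ⟨g, rfl⟩
  change outAb G (QuotientGroup.mk (innerAut G g)) = 1
  rw [h, map_one]

namespace MHat

open CompletedGroupAlgebra
open scoped commutatorElement

theorem mk_apply (γ : ContAut MHat) (z : MHat) : AHat.mk (γ z) = autAb MHat γ (AHat.mk z) := rfl

theorem apply_mem_derived (γ : ContAut MHat) (m : derived) : γ m ∈ derived := by
  rw [← AHat.mk_eq_one_iff, mk_apply, AHat.mk_eq_one_iff.2 m.2, map_one]

variable {m : derived} (hm : IsBasis m)

/-- The generalized Bachmuth determinant of `γ` for the basis `m` of `M̂'`: one has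
`γ m = m ^ det γ`. -/
def IsBasis.det (γ : ContAut MHat) : R :=
  (hm.surjective (γ m) (apply_mem_derived γ m)).choose

theorem IsBasis.dpow_det (γ : ContAut MHat) : dpow m (hm.det γ) = γ m :=
  (hm.surjective (γ m) (apply_mem_derived γ m)).choose_spec

theorem IsBasis.det_eq_of_dpow {γ : ContAut MHat} {u : R} (h : dpow m u = γ m) : hm.det γ = u :=
  hm.injective ((hm.dpow_det γ).trans h.symm)

theorem IsBasis.apply_dpow (γ : ContAut MHat) (r : R) :
    γ (dpow m r) = dpow m (map (autAb MHat γ).toHom r * hm.det γ) := by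
  have h := map_dpow m (φ := (γ : MHat →* MHat)) γ.continuous_toFun (g := (autAb MHat γ).toHom)
    (fun z => rfl) (m' := ⟨γ m, apply_mem_derived γ m⟩) rfl r
  exact h.trans (dpow_dpow m (hm.dpow_det γ) _)

/-- The determinant is a crossed homomorphism. -/
theorem IsBasis.det_mul (γ δ : ContAut MHat) :
    hm.det (γ * δ) = hm.det γ * map (autAb MHat γ).toHom (hm.det δ) := by
  refine hm.det_eq_of_dpow ?_
  rw [ContAut.mul_apply, ← hm.dpow_det δ, hm.apply_dpow, mul_comm]

theorem IsBasis.det_one : hm.det 1 = 1 := hm.det_eq_of_dpow (dpow_one m)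

theorem IsBasis.det_innerAut (z : MHat) : hm.det (innerAut MHat z) = of (AHat.mk z) :=
  hm.det_eq_of_dpow (dpow_of m z)

theorem IsBasis.det_mul_map_det_inv (γ : ContAut MHat) :
    hm.det γ * map (autAb MHat γ).toHom (hm.det γ⁻¹) = 1 := by
  rw [← hm.det_mul, mul_inv_cancel, hm.det_one]

/-- The generalized Bachmuth determinant as a unit. -/
def IsBasis.detUnit (γ : ContAut MHat) : Rˣ :=
  Units.mkOfMulEqOne _ _ (hm.det_mul_map_det_inv γ)

theorem IsBasis.val_detUnit (γ : ContAut MHat) : (hm.detUnit γ : R) = hm.det γ := rfl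

theorem IsBasis.isBachmuthDet_iff {γ : ContAut MHat} {u : Rˣ} :
    IsBachmuthDet (m : MHat) γ u ↔ hm.detUnit γ = u := by
  rw [IsBachmuthDet, isPow_iff, Units.ext_iff, hm.val_detUnit]
  exact ⟨hm.det_eq_of_dpow, fun h => h ▸ hm.dpow_det γ⟩

/-! ### The determinant on the abelianization -/

/-- The coordinates in `Ẑ²` of the image in `Â` of an element of `M̂`. -/
def coordVec : MHat →* Multiplicative (Fin 2 → ZHat) :=
  (AHat.coord.symm : AHat →* Multiplicative (Fin 2 → ZHat)).comp AHat.mk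

theorem continuous_coordVec (i : Fin 2) : Continuous fun z => (coordVec z).toAdd i :=
  (continuous_apply i).comp (AHat.coord.symm.continuous_toFun.comp AHat.continuous_mk)

/-- The determinant of the coordinate vectors of the images in `Â` of two elements of `M̂`. -/
def area (X Y : MHat) : ZHat :=
  (coordVec X).toAdd 0 * (coordVec Y).toAdd 1 - (coordVec X).toAdd 1 * (coordVec Y).toAdd 0

theorem area_gen : area (gen 0) (gen 1) = 1 := by
  have h0 : coordVec (gen 0) = .ofAdd (Pi.single 0 1) := AHat.coord_symm_gen 0
  have h1 : coordVec (gen 1) = .ofAdd (Pi.single 1 1) := AHat.coord_symm_gen 1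
  simp [area, h0, h1]

/-- The augmentation of the exponent of a commutator is an alternating bilinear form, hence a
multiple of the determinant. -/
theorem augmentation_commutator {w : R} (hw : dpow m w = ⁅gen 0, gen 1⁆) (X Y : MHat) :
    ∃ s, dpow m s = ⁅X, Y⁆ ∧ augmentation s = augmentation w * area X Y := by
  let P : MHat → MHat → Prop := fun X Y =>
    ∃ s, dpow m s = ⁅X, Y⁆ ∧ augmentation s = augmentation w * area X Y
  have hsymm : ∀ X Y, P X Y → P Y X := by
    rintro X Y ⟨s, hs, hs'⟩
    refine ⟨-s, ?_, ?_⟩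
    · rw [dpow_neg, hs, commutatorElement_inv]
    · rw [map_neg, hs']
      simp only [area]
      ring
  have hself : ∀ X, P X X := fun X =>
    ⟨0, by rw [dpow_zero, commutatorElement_self], by rw [map_zero]; simp only [area]; ring⟩
  let L : MHat → Subgroup MHat := fun Y =>
    { carrier := {X | P X Y}
      mul_mem' := by
        rintro X X' ⟨s, hs, hs'⟩ ⟨t, ht, ht'⟩
        refine ⟨of (AHat.mk X) * t + s, ?_, ?_⟩
        · rw [dpow_add, ← conj_dpow, hs, ht]
          simp only [commutatorElement_def]
          group
        · rw [map_add, map_mul, augmentation_of, hs', ht']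
          simp only [area, map_mul, toAdd_mul, Pi.add_apply]
          ring
      one_mem' := ⟨0, by rw [dpow_zero, commutatorElement_one_left], by
        rw [map_zero]; simp [area]⟩
      inv_mem' := by
        rintro X ⟨s, hs, hs'⟩
        refine ⟨of (AHat.mk X⁻¹) * -s, ?_, ?_⟩
        · rw [← conj_dpow, dpow_neg, hs]
          simp only [commutatorElement_def]
          group
        · rw [map_mul, map_neg, augmentation_of, hs']
          simp only [area, map_inv, toAdd_inv, Pi.neg_apply]
          ring }
  -- `L Y` is the projection of a closed set along the compact space of exponents `s`.
  have hL : ∀ Y, IsClosed (L Y : Set MHat) := by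
    intro Y
    have h : IsClosed {p : MHat × R | dpow m p.2 = ⁅p.1, Y⁆ ∧
        augmentation p.2 = augmentation w * area p.1 Y} := by
      have h0 := continuous_coordVec 0
      have h1 := continuous_coordVec 1
      have h2 := continuous_dpow m
      have h3 := continuous_augmentation (Q := AHat)
      refine (isClosed_eq (h2.comp continuous_snd) ?_).inter
        (isClosed_eq (h3.comp continuous_snd) ?_)
      · simp only [commutatorElement_def]
        fun_prop
      · exact continuous_const.mul (((h0.comp continuous_fst).mul continuous_const).sub
          ((h1.comp continuous_fst).mul continuous_const))
    convert isClosedMap_fst_of_compactSpace _ h using 1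
    ext X
    exact ⟨fun ⟨s, hs⟩ => ⟨(X, s), hs, rfl⟩, fun ⟨⟨X', s⟩, hs, hX⟩ => hX ▸ ⟨s, hs⟩⟩
  have h01 : P (gen 0) (gen 1) := ⟨w, hw, by rw [area_gen, mul_one]⟩
  have hgen : ∀ i j, P (gen i) (gen j) := by
    intro i j
    fin_cases i <;> fin_cases j
    · exact hself _
    · exact h01
    · exact hsymm _ _ h01
    · exact hself _
  have h1 : ∀ X j, P X (gen j) := fun X j => mem_of_gen_mem (hL (gen j)) (fun i => hgen i j) X
  exact mem_of_gen_mem (hL Y) (fun i => hsymm _ _ (h1 Y i)) X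

/-- The exponent of the commutator of the generators in a basis is a unit. -/
theorem IsBasis.exists_unit (hm : IsBasis m) : ∃ w : Rˣ, dpow m w = ⁅gen 0, gen 1⁆ := by
  obtain ⟨w, hw⟩ := hm.surjective _ (commutatorElement_mem_derived (gen 0) (gen 1))
  obtain ⟨v, hv⟩ := isBasis_genCommutator.surjective m m.2
  have h : v * w = 1 := hm.injective (by
    rw [← dpow_dpow m (m' := genCommutator) hw, hv, dpow_one])
  exact ⟨Units.mkOfMulEqOne w v ((mul_comm w v).trans h), hw⟩

/-- The matrix of an automorphism of `Â` in the standard coordinates. -/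
def _root_.AHat.toMatrix (g : ContAut AHat) : Matrix (Fin 2) (Fin 2) ZHat :=
  Matrix.of fun i j => (AHat.coord.symm (g (AHat.gen j))).toAdd i

/-- The determinant of an automorphism of `Â` in the standard coordinates. -/
def _root_.AHat.det (g : ContAut AHat) : ZHat := (AHat.toMatrix g).det

theorem area_eq_det {g : ContAut AHat} {X Y : MHat} (hX : AHat.mk X = g (AHat.gen 0))
    (hY : AHat.mk Y = g (AHat.gen 1)) : area X Y = AHat.det g := by
  have h0 : coordVec X = AHat.coord.symm (g (AHat.gen 0)) := congrArg AHat.coord.symm hX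
  have h1 : coordVec Y = AHat.coord.symm (g (AHat.gen 1)) := congrArg AHat.coord.symm hY
  rw [AHat.det, Matrix.det_fin_two, area, h0, h1]
  simp only [AHat.toMatrix, Matrix.of_apply]
  ring

theorem IsBasis.augmentation_det (γ : ContAut MHat) :
    augmentation (hm.det γ) = AHat.det (autAb MHat γ) := by
  obtain ⟨w, hw⟩ := hm.exists_unit
  obtain ⟨s, hs, hs'⟩ := augmentation_commutator hw (γ (gen 0)) (γ (gen 1))
  rw [← map_commutatorElement, ← hw, hm.apply_dpow] at hs
  rw [hm.injective hs, map_mul, augmentation_map,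
    area_eq_det (g := autAb MHat γ) (mk_apply γ _) (mk_apply γ _)] at hs'
  exact ((w.isUnit.map augmentation).mul_right_inj).1 hs'

/-! ### Construction of automorphisms -/

/-- Every pair of an automorphism `g` of `Â` and a unit of augmentation `det g` comes from an
automorphism of `M̂`. Lifting the images of the generators arbitrarily gives a commutator with the
correct augmentation; it is corrected by changing the lifts by elements of `M̂'`, since
`g x - 1` and `g y - 1` generate the augmentation ideal. -/
theorem IsBasis.exists_contAut (g : ContAut AHat) {u : R} (hu : IsUnit u)
    (hg : augmentation u = AHat.det g) : ∃ γ, autAb MHat γ = g ∧ hm.det γ = u := by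
  obtain ⟨w, hw⟩ := hm.exists_unit
  obtain ⟨X, hX⟩ := AHat.mk_surjective (g (AHat.gen 0))
  obtain ⟨Y, hY⟩ := AHat.mk_surjective (g (AHat.gen 1))
  obtain ⟨s, hs, hs'⟩ := augmentation_commutator hw X Y
  -- `[x, y] = m ^ w` has to be mapped to `m ^ (g w * u)`, while `[X, Y] = m ^ s`.
  have hε : augmentation (map g.toHom w * u) = augmentation s := by
    rw [map_mul, augmentation_map, hg, hs', area_eq_det hX hY]
  obtain ⟨p, q, hpq⟩ := Ideal.mem_span_pair.1 (mem_span_of_augmentation_eq g hε)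
  rw [← hX, ← hY] at hpq
  have hX' : of (AHat.mk X) * of (AHat.mk X)⁻¹ = 1 := by rw [← map_mul, mul_inv_cancel, map_one]
  have hY' : of (AHat.mk Y) * of (AHat.mk Y)⁻¹ = 1 := by rw [← map_mul, mul_inv_cancel, map_one]
  have hcomm := commutator_mul_dpow m hs.symm (-(of (AHat.mk X)⁻¹ * q)) (of (AHat.mk Y)⁻¹ * p)
  have hexp : s + of (AHat.mk X) * (1 - of (AHat.mk Y)) * -(of (AHat.mk X)⁻¹ * q) +
      of (AHat.mk Y) * (of (AHat.mk X) - 1) * (of (AHat.mk Y)⁻¹ * p) = map g.toHom w * u := by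
    linear_combination (-(1 - of (AHat.mk Y)) * q) * hX' + ((of (AHat.mk X) - 1) * p) * hY' + hpq
  rw [hexp] at hcomm
  obtain ⟨φ, hφ⟩ := exists_hom commutator_commutator
    ![X * dpow m (-(of (AHat.mk X)⁻¹ * q)), Y * dpow m (of (AHat.mk Y)⁻¹ * p)]
  have hφ0 : φ (gen 0) = X * dpow m (-(of (AHat.mk X)⁻¹ * q)) := hφ 0
  have hφ1 : φ (gen 1) = Y * dpow m (of (AHat.mk Y)⁻¹ * p) := hφ 1
  have hab : ∀ z, AHat.mk (φ z) = g.toHom (AHat.mk z) := fun z =>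
    hom_eq_of_gen (f := AHat.mk.comp (φ : MHat →* MHat))
      (g := (g : AHat →* AHat).comp AHat.mk) (AHat.continuous_mk.comp φ.continuous_toFun)
      (g.continuous_toFun.comp AHat.continuous_mk) (fun i => by
        fin_cases i
        · change AHat.mk (φ (gen 0)) = g (AHat.gen 0)
          rw [hφ0, map_mul, mk_dpow, mul_one, hX]
        · change AHat.mk (φ (gen 1)) = g (AHat.gen 1)
          rw [hφ1, map_mul, mk_dpow, mul_one, hY]) z
  have hφm : φ m ∈ derived := by
    rw [← AHat.mk_eq_one_iff, hab, AHat.mk_eq_one_iff.2 m.2, map_one]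
  obtain ⟨u', hu'⟩ := hm.surjective _ hφm
  have hpow : ∀ r, φ (dpow m r) = dpow m (map g.toHom r * u') := fun r =>
    (map_dpow m (φ := (φ : MHat →* MHat)) φ.continuous_toFun hab (m' := ⟨φ m, hφm⟩) rfl r).trans
      (dpow_dpow m hu' _)
  -- `φ m = m ^ u'`, and comparing exponents of `φ [x, y]` gives `g w * u' = g w * u`.
  have huu : u' = u := by
    rw [← hφ0, ← hφ1, ← map_commutatorElement, ← hw, hpow] at hcomm
    exact ((w.isUnit.map (map g.toHom)).mul_right_inj).1 (hm.injective hcomm)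
  subst huu
  obtain ⟨v, rfl⟩ := hu
  have hginv : ∀ r, map g.toHom (map (g⁻¹).toHom r) = r := fun r => by
    rw [← map_comp, show g.toHom.comp (g⁻¹).toHom = ContinuousMonoidHom.id AHat from
      ContinuousMonoidHom.ext fun q => ContAut.apply_inv_self _ g q, map_id]
  have hginv' : ∀ r, map (g⁻¹).toHom (map g.toHom r) = r := fun r => by
    rw [← map_comp, show (g⁻¹).toHom.comp g.toHom = ContinuousMonoidHom.id AHat from
      ContinuousMonoidHom.ext fun q => ContAut.inv_apply_self _ g q, map_id]
  have hinj : Function.Injective φ := by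
    refine (injective_iff_map_eq_one φ).2 fun z hz => ?_
    have h1 : AHat.mk z = 1 := by
      have := hab z
      rw [hz, map_one] at this
      exact g.injective (this.symm.trans (map_one g).symm)
    obtain ⟨r, rfl⟩ := hm.surjective z (AHat.mk_eq_one_iff.1 h1)
    rw [hpow, ← dpow_zero m] at hz
    have h2 : map g.toHom r = 0 := (Units.mul_left_eq_zero v).1 (hm.injective hz)
    rw [← hginv' r, h2, map_zero, dpow_zero]
  have hsurj : Function.Surjective φ := by
    intro z
    obtain ⟨z', hz'⟩ := AHat.mk_surjective (g⁻¹ (AHat.mk z))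
    have h1 : AHat.mk ((φ z')⁻¹ * z) = 1 := by
      rw [map_mul, map_inv, hab, hz', inv_mul_eq_one]
      exact ContAut.apply_inv_self _ g _
    obtain ⟨r, hr⟩ := hm.surjective _ (AHat.mk_eq_one_iff.1 h1)
    refine ⟨z' * dpow m (map (g⁻¹).toHom (r * ↑v⁻¹)), ?_⟩
    rw [map_mul, hpow, hginv, mul_assoc, Units.inv_mul, mul_one, hr, mul_inv_cancel_left]
  let e : MHat ≃* MHat := MulEquiv.ofBijective φ ⟨hinj, hsurj⟩
  let γ : ContAut MHat :=
    { e with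
      continuous_toFun := φ.continuous_toFun
      continuous_invFun := Continuous.continuous_symm_of_equiv_compact_to_t2
        (f := e.toEquiv) φ.continuous_toFun }
  refine ⟨γ, ContinuousMulEquiv.ext fun q => ?_, hm.det_eq_of_dpow hu'⟩
  obtain ⟨z, rfl⟩ := AHat.mk_surjective q
  exact hab z

/-- An automorphism acting trivially on `Â` and on `M̂'` is inner, by exactness of the Koszul
complex. -/
theorem IsBasis.mem_inn_of_det_eq_one {γ : ContAut MHat} (hab : autAb MHat γ = 1)
    (hdet : hm.det γ = 1) : γ ∈ Inn MHat := by
  have hex : ∀ i, ∃ a, γ (gen i) = gen i * dpow m a := by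
    intro i
    have h1 : AHat.mk ((gen i)⁻¹ * γ (gen i)) = 1 := by
      rw [map_mul, map_inv, mk_apply, hab, inv_mul_eq_one]
      rfl
    obtain ⟨a, ha⟩ := hm.surjective _ (AHat.mk_eq_one_iff.1 h1)
    exact ⟨a, by rw [ha, mul_inv_cancel_left]⟩
  obtain ⟨a, ha⟩ := hex 0
  obtain ⟨b, hb⟩ := hex 1
  obtain ⟨w, hw⟩ := hm.exists_unit
  have h1 := hm.apply_dpow γ w
  have h2 : map (1 : ContAut AHat).toHom (w : R) = w := map_id _
  rw [hdet, mul_one, hab, h2, hw, map_commutatorElement, ha, hb,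
    commutator_mul_dpow m hw.symm, ← hw] at h1
  have h3 := hm.injective h1
  obtain ⟨t, ht0, ht1⟩ := exists_koszul (a := of (AHat.gen 0) * a) (b := of (AHat.gen 1) * b) (by
    change _ + of (AHat.gen 0) * (1 - of (AHat.gen 1)) * a +
      of (AHat.gen 1) * (of (AHat.gen 0) - 1) * b = _ at h3
    linear_combination h3)
  -- `a = t - x⁻¹ t` is the change of `x` under conjugation by `m ^ (-t)`, and similarly for `y`.
  have hi : ∀ (i : Fin 2) (a : R), of (AHat.gen i) * a = (of (AHat.gen i) - 1) * t →
      γ (gen i) = gen i * dpow m a → innerAut MHat (dpow m (-t)) (gen i) = γ (gen i) := by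
    intro i a hat hγ
    have h4 : of (AHat.gen i)⁻¹ * of (AHat.gen i) = 1 := by rw [← map_mul, inv_mul_cancel, map_one]
    have h5 : a = of (AHat.mk (gen i)⁻¹) * -t + t := by
      rw [map_inv]
      change a = of (AHat.gen i)⁻¹ * -t + t
      linear_combination of (AHat.gen i)⁻¹ * hat - (a - t) * h4
    rw [innerAut_apply, hγ, h5, dpow_add, ← conj_dpow, dpow_neg, inv_inv]
    group
  refine ⟨dpow m (-t), ContinuousMulEquiv.ext fun z => ?_⟩
  refine hom_eq_of_gen (f := (innerAut MHat (dpow m (-t)) : MHat →* MHat))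
    (g := (γ : MHat →* MHat)) (innerAut MHat (dpow m (-t))).continuous_toFun γ.continuous_toFun
    (fun i => ?_) z
  fin_cases i
  · exact hi 0 a ht0 ha
  · exact hi 1 b ht1 hb

/-- An outer automorphism is determined by its action on `Â` and its reduced determinant. -/
theorem IsBasis.out_eq_iff {γ δ : ContAut MHat} :
    (QuotientGroup.mk γ : Out MHat) = QuotientGroup.mk δ ↔
      autAb MHat γ = autAb MHat δ ∧ ∃ q, hm.det δ = hm.det γ * of q := by
  constructor
  · intro h
    obtain ⟨z, hz⟩ := QuotientGroup.eq.1 h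
    have h1 : δ = γ * innerAut MHat z := by rw [hz, mul_inv_cancel_left]
    refine ⟨?_, autAb MHat γ (AHat.mk z), ?_⟩
    · rw [h1, map_mul, autAb_innerAut, mul_one]
    · rw [h1, hm.det_mul, hm.det_innerAut, map_of]
      rfl
  · -- An inner automorphism makes up for the difference `q` of the determinants.
    rintro ⟨hab, q, hq⟩
    obtain ⟨z, hz⟩ := AHat.mk_surjective ((autAb MHat γ)⁻¹ q)
    have h1 : γ⁻¹ * δ * innerAut MHat z⁻¹ ∈ Inn MHat := by
      refine hm.mem_inn_of_det_eq_one ?_ ?_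
      · rw [map_mul, map_mul, map_inv, hab, autAb_innerAut, mul_one, inv_mul_cancel]
      · have h2 : autAb MHat (γ⁻¹ * δ) = 1 := by
          rw [map_mul, map_inv, hab, inv_mul_cancel]
        have h3 : map (1 : ContAut AHat).toHom (of (AHat.mk z⁻¹)) = of (AHat.mk z⁻¹) := map_id _
        have h4 := hm.det_mul_map_det_inv γ⁻¹
        rw [inv_inv] at h4
        have h5 : map (autAb MHat γ⁻¹).toHom (of q) = of (AHat.mk z) := by
          rw [map_of, hz, map_inv]
          rfl
        rw [hm.det_mul, h2, hm.det_innerAut, h3, hm.det_mul, hq, map_mul, ← mul_assoc, h4, one_mul,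
          h5, ← map_mul, ← map_mul, mul_inv_cancel, map_one, map_one]
    have h6 : innerAut MHat z⁻¹ ∈ Inn MHat := ⟨z⁻¹, rfl⟩
    exact QuotientGroup.eq.2 ((Subgroup.mul_mem_cancel_right _ h6).1 h1)

end MHat

/-! ### Determinants of automorphisms of the abelianization -/

/-- A continuous endomorphism of `Ẑ²` is given by a matrix. -/
theorem ZHat.apply_eq_mulVec
    {T : Multiplicative (Fin 2 → ZHat) →* Multiplicative (Fin 2 → ZHat)} (hT : Continuous T)
    (v : Fin 2 → ZHat) :
    T (.ofAdd v) = .ofAdd ((Matrix.of fun i j =>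
      (T (.ofAdd (Pi.single j 1))).toAdd i).mulVec v) := by
  set A : Matrix (Fin 2) (Fin 2) ZHat := Matrix.of fun i j =>
    (T (.ofAdd (Pi.single j 1))).toAdd i with hA
  let L : Multiplicative (Fin 2 → ZHat) →* Multiplicative (Fin 2 → ZHat) :=
    AddMonoidHom.toMultiplicative A.mulVecLin.toAddMonoidHom
  have hL : Continuous fun v : Fin 2 → ZHat => A.mulVec v :=
    Continuous.matrix_mulVec continuous_const continuous_id
  refine ZHat.mem_of_single_mem (S := Subgroup.toAddSubgroup' (T.eqLocus L))
    (isClosed_eq hT hL) (fun j => ?_) v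
  change T (.ofAdd (Pi.single j 1)) = .ofAdd (A.mulVec (Pi.single j 1))
  rw [Matrix.mulVec_single_one]
  rfl

theorem Matrix.eq_of_mulVec_eq {A B : Matrix (Fin 2) (Fin 2) ZHat}
    (h : ∀ v, A.mulVec v = B.mulVec v) : A = B := by
  refine Matrix.ext fun i j => ?_
  have := congrFun (h (Pi.single j 1)) i
  rwa [Matrix.mulVec_single_one, Matrix.mulVec_single_one] at this

namespace AHat

theorem apply_coord (g : ContAut AHat) (v : Fin 2 → ZHat) :
    g (coord (.ofAdd v)) = coord (.ofAdd ((toMatrix g).mulVec v)) := by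
  have h := congrArg coord (ZHat.apply_eq_mulVec
    (T := ((coord.symm : AHat →* Multiplicative (Fin 2 → ZHat)).comp (g : AHat →* AHat)).comp
      (coord : Multiplicative (Fin 2 → ZHat) →* AHat))
    (coord.symm.continuous_toFun.comp (g.continuous_toFun.comp coord.continuous_toFun)) v)
  change coord (coord.symm (g (coord (.ofAdd v)))) = coord (.ofAdd ((Matrix.of fun i j =>
    (coord.symm (g (coord (.ofAdd (Pi.single j 1))))).toAdd i).mulVec v)) at h
  simp only [coord_single] at h
  exact (coord.toEquiv.apply_symm_apply _).symm.trans h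

theorem hasDet_det (g : ContAut AHat) : HasDet g (det g) := ⟨coord, _, apply_coord g, rfl⟩

theorem hasDet_unique {g : ContAut AHat} {d d' : ZHat} (h : HasDet g d) (h' : HasDet g d') :
    d = d' := by
  obtain ⟨e, P, hP, rfl⟩ := h
  obtain ⟨e', P', hP', rfl⟩ := h'
  -- the change of basis and its inverse
  have hmat : ∀ e e' : Multiplicative (Fin 2 → ZHat) ≃ₜ* AHat,
      ∃ A : Matrix (Fin 2) (Fin 2) ZHat, ∀ v, e (.ofAdd v) = e' (.ofAdd (A.mulVec v)) := by
    intro e e'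
    have h := ZHat.apply_eq_mulVec
      (T := (e'.symm : AHat →* Multiplicative (Fin 2 → ZHat)).comp
        (e : Multiplicative (Fin 2 → ZHat) →* AHat))
      (e'.symm.continuous_toFun.comp e.continuous_toFun)
    exact ⟨_, fun v => (e'.toEquiv.apply_symm_apply _).symm.trans (congrArg e' (h v))⟩
  obtain ⟨A, hA⟩ := hmat e e'
  obtain ⟨B, hB⟩ := hmat e' e
  have hinj : ∀ v w, e' (.ofAdd v) = e' (.ofAdd w) → v = w := fun v w hvw => e'.injective hvw
  have hAB : A * B = 1 := Matrix.eq_of_mulVec_eq fun v => by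
    rw [← Matrix.mulVec_mulVec, Matrix.one_mulVec]
    exact hinj _ _ (by rw [← hA, ← hB])
  have hAP : A * P = P' * A := Matrix.eq_of_mulVec_eq fun v => by
    rw [← Matrix.mulVec_mulVec, ← Matrix.mulVec_mulVec]
    exact hinj _ _ (by rw [← hA, ← hP, hA, hP'])
  have h1 := congrArg Matrix.det hAB
  have h2 := congrArg Matrix.det hAP
  rw [Matrix.det_mul, Matrix.det_one] at h1
  rw [Matrix.det_mul, Matrix.det_mul] at h2
  linear_combination B.det * h2 - (P.det - P'.det) * h1

theorem hasDet_iff {g : ContAut AHat} {d : ZHat} : HasDet g d ↔ det g = d :=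
  ⟨fun h => hasDet_unique (hasDet_det g) h, fun h => h ▸ hasDet_det g⟩

theorem det_mul (g h : ContAut AHat) : det (g * h) = det g * det h := by
  rw [det.eq_1 g, det.eq_1 h, ← Matrix.det_mul]
  refine hasDet_unique (hasDet_det _) ⟨coord, _, fun v => ?_, rfl⟩
  rw [ContAut.mul_apply, apply_coord, apply_coord, Matrix.mulVec_mulVec]

theorem det_one : det 1 = 1 :=
  hasDet_iff.1 ⟨coord, 1, fun v => by rw [Matrix.one_mulVec]; rfl, Matrix.det_one⟩

/-- The determinant of an automorphism of `Â`, as a unit. -/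
def detUnit (g : ContAut AHat) : ZHatˣ :=
  Units.mkOfMulEqOne (det g) (det g⁻¹) (by rw [← det_mul, mul_inv_cancel, det_one])

end AHat

/-! ### The topology of automorphism groups -/

namespace ContAut

variable {G : Type} [Group G] [TopologicalSpace G]

/-- A continuous automorphism as a continuous map. -/
def toContinuousMap (γ : ContAut G) : C(G, G) := ⟨γ, γ.continuous_toFun⟩

theorem isInducing_toContinuousMap : IsInducing (toContinuousMap (G := G)) := ⟨rfl⟩

theorem toContinuousMap_injective : Function.Injective (toContinuousMap (G := G)) :=
  fun _ _ h => ContinuousMulEquiv.ext fun x => DFunLike.congr_fun h x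

instance [T2Space G] : T2Space (ContAut G) :=
  T2Space.of_injective_continuous toContinuousMap_injective isInducing_toContinuousMap.continuous

theorem continuous_of_uncurry {X : Type*} [TopologicalSpace X] {f : X → ContAut G}
    (h : Continuous fun p : X × G => f p.1 p.2) : Continuous f :=
  isInducing_toContinuousMap.continuous_iff.2 (ContinuousMap.continuous_of_continuous_uncurry _ h)

theorem continuous_apply [LocallyCompactSpace G] :
    Continuous fun p : ContAut G × G => p.1 p.2 :=
  (continuous_eval (F := C(G, G))).comp
    (isInducing_toContinuousMap.continuous.prodMap continuous_id)

instance [LocallyCompactSpace G] : ContinuousMul (ContAut G) := by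
  refine ⟨continuous_of_uncurry ?_⟩
  change Continuous fun p : (ContAut G × ContAut G) × G => p.1.1 (p.1.2 p.2)
  exact continuous_apply.comp ((continuous_fst.comp continuous_fst).prodMk
    (continuous_apply.comp ((continuous_snd.comp continuous_fst).prodMk continuous_snd)))

theorem continuous_innerAut [IsTopologicalGroup G] : Continuous (innerAut G) := by
  refine continuous_of_uncurry ?_
  change Continuous fun p : G × G => p.1 * p.2 * p.1⁻¹
  fun_prop

theorem continuous_autAb [IsTopologicalGroup G] [LocallyCompactSpace G] :
    Continuous (autAb G) := by
  refine continuous_of_uncurry ?_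
  have hq : IsQuotientMap (Prod.map (id : ContAut G → ContAut G)
      (QuotientGroup.mk : G → TopologicalAbelianization G)) :=
    (IsOpenQuotientMap.id.prodMap QuotientGroup.isOpenQuotientMap_mk).isQuotientMap
  rw [hq.continuous_iff]
  exact QuotientGroup.continuous_mk.comp continuous_apply

theorem continuous_outAb [IsTopologicalGroup G] [LocallyCompactSpace G] : Continuous (outAb G) :=
  continuous_autAb.quotient_lift _

end ContAut

namespace MHat

/-- The continuous endomorphism of `M̂` with given values on the generators. -/
def endo (p : MHat × MHat) : MHat →ₜ* MHat :=
  (exists_hom commutator_commutator ![p.1, p.2]).choose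

theorem endo_gen (p : MHat × MHat) (i : Fin 2) : endo p (gen i) = ![p.1, p.2] i :=
  (exists_hom commutator_commutator ![p.1, p.2]).choose_spec i

/-- Joint continuity: modulo an open normal subgroup `N`, the endomorphism `endo p` depends only on
`p` modulo `N`. -/
theorem continuous_endo : Continuous fun p : (MHat × MHat) × MHat => endo p.1 p.2 := by
  refine continuous_iff_continuousAt.2 fun p => ?_
  intro U hU
  obtain ⟨V, hVU, hV, hpV⟩ := mem_nhds_iff.1 hU
  obtain ⟨N, hN⟩ := ProfiniteGrp.exist_openNormalSubgroup_sub_open_nhds_of_one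
    (hV.preimage (by fun_prop : Continuous fun z => endo p.1 p.2 * z))
    (by change endo p.1 p.2 * 1 ∈ V; rwa [mul_one])
  let L : Subgroup MHat := N.toSubgroup
  have hLo : IsOpen (L : Set MHat) := N.isOpen
  have : DiscreteTopology (MHat ⧸ L) := QuotientGroup.discreteTopology hLo
  have hmk : Continuous (QuotientGroup.mk : MHat → MHat ⧸ L) := QuotientGroup.continuous_mk
  have hc : Continuous fun q : (MHat × MHat) × MHat =>
      ((q.1.1 : MHat ⧸ L), (q.1.2 : MHat ⧸ L), ((endo p.1 q.2 : MHat) : MHat ⧸ L)) :=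
    (hmk.comp (continuous_fst.comp continuous_fst)).prodMk
      ((hmk.comp (continuous_snd.comp continuous_fst)).prodMk
        (hmk.comp ((endo p.1).continuous_toFun.comp continuous_snd)))
  have hev := ((isOpen_discrete {((p.1.1 : MHat ⧸ L), (p.1.2 : MHat ⧸ L),
    ((endo p.1 p.2 : MHat) : MHat ⧸ L))}).preimage hc).mem_nhds (x := p) rfl
  rw [Filter.mem_map]
  filter_upwards [hev] with q hq
  have hq1 : (q.1.1 : MHat ⧸ L) = p.1.1 := congrArg Prod.fst hq
  have hq2 : (q.1.2 : MHat ⧸ L) = p.1.2 := congrArg (fun t => t.2.1) hq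
  have hq3 : ((endo p.1 q.2 : MHat) : MHat ⧸ L) = endo p.1 p.2 := congrArg (fun t => t.2.2) hq
  have h1 : ((endo q.1 q.2 : MHat) : MHat ⧸ L) = endo p.1 q.2 :=
    hom_eq_of_gen (f := (QuotientGroup.mk' L).comp (endo q.1 : MHat →* MHat))
      (g := (QuotientGroup.mk' L).comp (endo p.1 : MHat →* MHat))
      (hmk.comp (endo q.1).continuous_toFun) (hmk.comp (endo p.1).continuous_toFun) (fun i => by
        change ((endo q.1 (gen i) : MHat) : MHat ⧸ L) = endo p.1 (gen i)
        rw [endo_gen, endo_gen]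
        fin_cases i
        · exact hq1
        · exact hq2) q.2
  have h2 : (endo p.1 p.2)⁻¹ * endo q.1 q.2 ∈ L := QuotientGroup.eq.1 (h1.trans hq3).symm
  have h3 := hN h2
  change endo p.1 p.2 * ((endo p.1 p.2)⁻¹ * endo q.1 q.2) ∈ V at h3
  rw [mul_inv_cancel_left] at h3
  exact hVU h3

/-- The automorphisms are the invertible elements of the compact monoid of endomorphisms. -/
instance : CompactSpace (ContAut MHat) := by
  let H : Set C(MHat, MHat) :=
    Set.range fun p => (⟨endo p, (endo p).continuous_toFun⟩ : C(MHat, MHat))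
  have hH : IsCompact H :=
    isCompact_range (ContinuousMap.continuous_of_continuous_uncurry _ continuous_endo)
  have hmem : ∀ γ : ContAut MHat, γ.toContinuousMap ∈ H := fun γ =>
    ⟨(γ (gen 0), γ (gen 1)), ContinuousMap.ext fun z =>
      hom_eq_of_gen (f := (endo (γ (gen 0), γ (gen 1)) : MHat →* MHat)) (g := (γ : MHat →* MHat))
        (endo _).continuous_toFun γ.continuous_toFun (fun i => by
          refine (endo_gen _ i).trans ?_
          fin_cases i <;> rfl) z⟩
  let P : Set (C(MHat, MHat) × C(MHat, MHat)) :=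
    (H ×ˢ H) ∩ {p | p.1.comp p.2 = ContinuousMap.id _ ∧ p.2.comp p.1 = ContinuousMap.id _}
  have hP : IsCompact P := by
    refine (hH.prod hH).inter_right (IsClosed.inter ?_ ?_)
    · exact isClosed_eq (continuous_fst.compCM continuous_snd) continuous_const
    · exact isClosed_eq (continuous_snd.compCM continuous_fst) continuous_const
  have hr : Set.range (ContAut.toContinuousMap (G := MHat)) = Prod.fst '' P := by
    ext f
    constructor
    · rintro ⟨γ, rfl⟩
      refine ⟨(γ.toContinuousMap, (γ⁻¹).toContinuousMap), ⟨⟨hmem _, hmem _⟩, ?_, ?_⟩, rfl⟩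
      · exact ContinuousMap.ext fun z => ContAut.apply_inv_self _ γ z
      · exact ContinuousMap.ext fun z => ContAut.inv_apply_self _ γ z
    · rintro ⟨⟨f, g⟩, ⟨⟨⟨p, hp⟩, -⟩, h1, h2⟩, rfl⟩
      refine ⟨{ toFun := f
                invFun := g
                left_inv := fun z => DFunLike.congr_fun h2 z
                right_inv := fun z => DFunLike.congr_fun h1 z
                map_mul' := fun a b => by
                  have hp' : ∀ z, endo p z = f z := fun z => DFunLike.congr_fun hp z
                  rw [← hp', ← hp', ← hp', map_mul]
                continuous_toFun := f.continuous
                continuous_invFun := g.continuous }, rfl⟩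
  rw [← isCompact_univ_iff, ContAut.isInducing_toContinuousMap.isCompact_iff, Set.image_univ, hr]
  exact hP.image continuous_fst

instance : IsTopologicalGroup (ContAut MHat) where
  continuous_inv := by
    refine continuous_of_isClosed_graph ?_
    have h : {p : ContAut MHat × ContAut MHat | p.2 = p.1⁻¹} = {p | p.1 * p.2 = 1} := by
      ext p
      exact eq_inv_iff_mul_eq_one.trans mul_eq_one_comm
    rw [h]
    exact isClosed_eq continuous_mul continuous_const

instance : IsClosed (Inn MHat : Set (ContAut MHat)) :=
  (isCompact_range ContAut.continuous_innerAut).isClosed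

variable {m : derived} (hm : IsBasis m)

theorem IsBasis.continuous_det : Continuous hm.det := by
  refine continuous_of_isClosed_graph ?_
  have h : {p : ContAut MHat × R | p.2 = hm.det p.1} = {p | dpow m p.2 = p.1 m} := by
    ext p
    exact ⟨fun hp => by rw [Set.mem_ofPred_eq, show p.2 = _ from hp, hm.dpow_det],
      fun hp => (hm.det_eq_of_dpow hp).symm⟩
  rw [h]
  exact isClosed_eq ((continuous_dpow m).comp continuous_snd)
    (ContAut.continuous_apply.comp (continuous_fst.prodMk continuous_const))

end MHat

instance {A : Type*} [Monoid A] [TopologicalSpace A] [T1Space A] [ContinuousMul A]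
    [CompactSpace A] : CompactSpace Aˣ := by
  have : CompactSpace Aᵐᵒᵖ := inferInstance
  exact Units.isClosedEmbedding_embedProduct.compactSpace

instance : CompactSpace (specialUnits AHat) := by
  refine isCompact_iff_compactSpace.1 (IsClosed.isCompact ?_)
  have h : (specialUnits AHat : Set (CompletedGroupAlgebra AHat)ˣ) =
      {u : (CompletedGroupAlgebra AHat)ˣ |
        CompletedGroupAlgebra.augmentation (u : CompletedGroupAlgebra AHat) = 1} :=
    Set.ext fun u => mem_specialUnits
  rw [h]
  exact isClosed_eq (CompletedGroupAlgebra.continuous_augmentation.comp Units.continuous_val)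
    continuous_const

/-! ### The structure of the group of outer automorphisms -/

namespace MHat

open CompletedGroupAlgebra

variable {m : derived} (hm : IsBasis m)

theorem IsBasis.isReducedDet_mk {γ : ContAut MHat} {δ : ReducedUnits AHat} :
    IsReducedDet (m : MHat) (QuotientGroup.mk γ) δ ↔ QuotientGroup.mk (hm.detUnit γ) = δ := by
  constructor
  · rintro ⟨γ', u, hγ, hu, rfl⟩
    obtain rfl := hm.isBachmuthDet_iff.1 hu
    obtain ⟨-, q, hq⟩ := hm.out_eq_iff.1 hγ
    have h : (hm.detUnit γ')⁻¹ * hm.detUnit γ ∈ (groupLike AHat).range :=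
      ⟨q, eq_inv_mul_of_mul_eq (Units.ext hq.symm)⟩
    exact (QuotientGroup.eq.2 h).symm
  · rintro rfl
    exact ⟨γ, hm.detUnit γ, rfl, hm.isBachmuthDet_iff.2 rfl, rfl⟩

theorem IsBasis.exists_kernelLift (u : specialUnits AHat) :
    ∃ γ, autAb MHat γ = 1 ∧ hm.det γ = ((u : Rˣ) : R) :=
  hm.exists_contAut 1 u.1.isUnit ((mem_specialUnits.1 u.2).trans AHat.det_one.symm)

/-- The outer automorphism acting trivially on `Â` with a given determinant. The choice of a
representative does not matter, by `IsBasis.out_eq_iff`. -/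
def IsBasis.unitToOut : specialUnits AHat →* Out MHat where
  toFun u := QuotientGroup.mk (hm.exists_kernelLift u).choose
  map_one' := by
    refine hm.out_eq_iff.2 ⟨?_, 1, ?_⟩
    · rw [(hm.exists_kernelLift 1).choose_spec.1, map_one]
    · rw [(hm.exists_kernelLift 1).choose_spec.2, hm.det_one, map_one, mul_one]
      rfl
  map_mul' u v := by
    refine hm.out_eq_iff.2 ⟨?_, 1, ?_⟩
    · rw [map_mul, (hm.exists_kernelLift _).choose_spec.1, (hm.exists_kernelLift u).choose_spec.1,
        (hm.exists_kernelLift v).choose_spec.1, mul_one]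
    · have h : map (1 : ContAut AHat).toHom ((v : Rˣ) : R) = (v : Rˣ) := map_id _
      rw [hm.det_mul, (hm.exists_kernelLift (u * v)).choose_spec.2,
        (hm.exists_kernelLift u).choose_spec.2, (hm.exists_kernelLift v).choose_spec.2,
        (hm.exists_kernelLift u).choose_spec.1, h, map_one, mul_one]
      rfl

theorem IsBasis.unitToOut_eq {u : specialUnits AHat} {γ : ContAut MHat}
    (h1 : autAb MHat γ = 1) (h2 : hm.det γ = ((u : Rˣ) : R)) :
    hm.unitToOut u = QuotientGroup.mk γ :=
  hm.out_eq_iff.2 ⟨(hm.exists_kernelLift u).choose_spec.1.trans h1.symm, 1, by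
    rw [h2, (hm.exists_kernelLift u).choose_spec.2, map_one, mul_one]⟩

/-- The kernel consists of the group-like units, the determinants of the inner automorphisms. -/
theorem IsBasis.unitToOut_eq_one_iff {u : specialUnits AHat} :
    hm.unitToOut u = 1 ↔ u ∈ (groupLike AHat).range.subgroupOf (specialUnits AHat) := by
  obtain ⟨γ, h1, h2⟩ := hm.exists_kernelLift u
  rw [hm.unitToOut_eq h1 h2, eq_comm]
  refine (hm.out_eq_iff (γ := 1)).trans ?_
  rw [hm.det_one, map_one, h1, h2]
  constructor
  · rintro ⟨-, q, hq⟩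
    refine ⟨q, Units.ext ?_⟩
    rw [one_mul] at hq
    exact hq.symm
  · rintro ⟨q, hq⟩
    refine ⟨rfl, q, ?_⟩
    rw [one_mul]
    exact (congrArg Units.val hq).symm

/-- The inverse of the reduced determinant on the kernel of `ab_*`. -/
def IsBasis.reducedUnitToOut : ReducedSpecialUnits AHat →* Out MHat :=
  QuotientGroup.lift _ hm.unitToOut fun _ hu => hm.unitToOut_eq_one_iff.2 hu

theorem IsBasis.continuous_unitToOut : Continuous hm.unitToOut := by
  refine continuous_of_isClosed_graph ?_
  let K : Set (specialUnits AHat × ContAut MHat) :=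
    {p | autAb MHat p.2 = 1 ∧ hm.det p.2 = ((p.1 : Rˣ) : R)}
  have hK : IsClosed K := by
    refine (isClosed_eq (ContAut.continuous_autAb.comp continuous_snd) continuous_const).inter
      (isClosed_eq (hm.continuous_det.comp continuous_snd) ?_)
    exact Units.continuous_val.comp (continuous_subtype_val.comp continuous_fst)
  have h : {p : specialUnits AHat × Out MHat | p.2 = hm.unitToOut p.1} =
      Prod.map id QuotientGroup.mk '' K := by
    ext ⟨u, x⟩
    constructor
    · intro hx
      obtain ⟨γ, h1, h2⟩ := hm.exists_kernelLift u
      refine ⟨(u, γ), ⟨h1, h2⟩, Prod.ext rfl ?_⟩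
      exact (hm.unitToOut_eq h1 h2).symm.trans (Eq.symm hx)
    · rintro ⟨⟨v, γ⟩, ⟨h1, h2⟩, hp⟩
      obtain rfl : v = u := congrArg Prod.fst hp
      exact (congrArg Prod.snd hp).symm.trans (hm.unitToOut_eq h1 h2).symm
  rw [h]
  exact (hK.isCompact.image (continuous_id.prodMap QuotientGroup.continuous_mk)).isClosed

theorem IsBasis.continuous_reducedUnitToOut : Continuous hm.reducedUnitToOut :=
  hm.continuous_unitToOut.quotient_lift _

theorem IsBasis.isReducedDet_reducedUnitToOut (u : specialUnits AHat) :
    IsReducedDet (m : MHat) (hm.reducedUnitToOut (QuotientGroup.mk u)) (QuotientGroup.mk u.1) := by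
  obtain ⟨γ, h1, h2⟩ := hm.exists_kernelLift u
  change IsReducedDet (m : MHat) (hm.unitToOut u) _
  rw [hm.unitToOut_eq h1 h2, hm.isReducedDet_mk]
  exact congrArg QuotientGroup.mk (Units.ext h2)

theorem IsBasis.reducedUnitToOut_injective : Function.Injective hm.reducedUnitToOut := by
  refine (injective_iff_map_eq_one _).2 fun k hk => ?_
  induction k using QuotientGroup.induction_on with
  | H u => exact (QuotientGroup.eq_one_iff u).2 (hm.unitToOut_eq_one_iff.1 hk)

theorem IsBasis.range_reducedUnitToOut : hm.reducedUnitToOut.range = (outAb MHat).ker := by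
  ext x
  constructor
  · rintro ⟨k, rfl⟩
    induction k using QuotientGroup.induction_on with
    | H u => exact (hm.exists_kernelLift u).choose_spec.1
  · induction x using QuotientGroup.induction_on with
    | H γ =>
      intro hγ
      have h1 : autAb MHat γ = 1 := hγ
      have h2 : hm.detUnit γ ∈ specialUnits AHat := by
        rw [mem_specialUnits, hm.val_detUnit, hm.augmentation_det, h1, AHat.det_one]
      exact ⟨QuotientGroup.mk ⟨hm.detUnit γ, h2⟩, hm.unitToOut_eq h1 rfl⟩

theorem IsBasis.exists_scalarLift (g : ContAut AHat) :
    ∃ γ, autAb MHat γ = g ∧ hm.det γ = scalar (AHat.det g) :=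
  hm.exists_contAut g ((AHat.detUnit g).isUnit.map scalar) (augmentation_scalar _)

/-- The section of `ab_*` with braid-like values: `g` goes to the outer automorphism inducing `g`
with determinant the scalar `det g`. -/
def IsBasis.braidSection : ContAut AHat →* Out MHat where
  toFun g := QuotientGroup.mk (hm.exists_scalarLift g).choose
  map_one' := by
    refine hm.out_eq_iff.2 ⟨?_, 1, ?_⟩
    · rw [(hm.exists_scalarLift 1).choose_spec.1, map_one]
    · rw [(hm.exists_scalarLift 1).choose_spec.2, hm.det_one, AHat.det_one, map_one, map_one,
        mul_one]
  map_mul' g h := by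
    refine hm.out_eq_iff.2 ⟨?_, 1, ?_⟩
    · rw [map_mul, (hm.exists_scalarLift _).choose_spec.1, (hm.exists_scalarLift g).choose_spec.1,
        (hm.exists_scalarLift h).choose_spec.1]
    · rw [hm.det_mul, (hm.exists_scalarLift (g * h)).choose_spec.2,
        (hm.exists_scalarLift g).choose_spec.2, (hm.exists_scalarLift h).choose_spec.2,
        map_scalar, AHat.det_mul, map_mul, map_one, mul_one]

theorem IsBasis.braidSection_eq {γ : ContAut MHat}
    (h : hm.det γ = scalar (AHat.det (autAb MHat γ))) :
    hm.braidSection (autAb MHat γ) = QuotientGroup.mk γ :=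
  hm.out_eq_iff.2 ⟨(hm.exists_scalarLift _).choose_spec.1, 1, by
    rw [h, (hm.exists_scalarLift _).choose_spec.2, map_one, mul_one]⟩

theorem IsBasis.outAb_braidSection (g : ContAut AHat) : outAb MHat (hm.braidSection g) = g :=
  (hm.exists_scalarLift g).choose_spec.1

theorem IsBasis.continuous_braidSection : Continuous hm.braidSection := by
  refine continuous_of_isClosed_graph ?_
  -- By `augmentation_det`, the condition `det γ = det (ab_* γ)` amounts to this closed one.
  let K : Set (ContAut MHat) := {γ | hm.det γ = scalar (augmentation (hm.det γ))}
  have hK : IsClosed K := isClosed_eq hm.continuous_det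
    (continuous_scalar.comp (continuous_augmentation.comp hm.continuous_det))
  have h : {p : ContAut AHat × Out MHat | p.2 = hm.braidSection p.1} =
      (fun γ => (autAb MHat γ, QuotientGroup.mk γ)) '' K := by
    ext ⟨g, x⟩
    constructor
    · intro hx
      obtain ⟨γ, rfl, h2⟩ := hm.exists_scalarLift g
      refine ⟨γ, ?_, Prod.ext rfl ((hm.braidSection_eq h2).symm.trans (Eq.symm hx))⟩
      change hm.det γ = scalar (augmentation (hm.det γ))
      rw [h2, augmentation_scalar]
    · rintro ⟨γ, hγ, hp⟩
      obtain rfl : autAb MHat γ = g := congrArg Prod.fst hp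
      refine (congrArg Prod.snd hp).symm.trans (hm.braidSection_eq ?_).symm
      rw [← hm.augmentation_det]
      exact hγ
  rw [h]
  exact (hK.isCompact.image (ContAut.continuous_autAb.prodMk QuotientGroup.continuous_mk)).isClosed

theorem IsBasis.range_braidSection :
    (hm.braidSection.range : Set (Out MHat)) = braidLike (m : MHat) := by
  ext x
  constructor
  · rintro ⟨g, rfl⟩
    obtain ⟨γ, rfl, h2⟩ := hm.exists_scalarLift g
    rw [hm.braidSection_eq h2]
    refine ⟨AHat.detUnit (autAb MHat γ), AHat.hasDet_det _, hm.isReducedDet_mk.2 ?_⟩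
    exact congrArg QuotientGroup.mk (Units.ext h2)
  · induction x using QuotientGroup.induction_on with
    | H γ =>
      rintro ⟨d, hd, hred⟩
      have hd' : AHat.det (autAb MHat γ) = d := AHat.hasDet_iff.1 hd
      obtain ⟨q, hq⟩ := QuotientGroup.eq.1 (hm.isReducedDet_mk.1 hred)
      rw [eq_inv_mul_iff_mul_eq] at hq
      have hq' : hm.det γ * of q = scalar (d : ZHat) := congrArg Units.val hq
      obtain ⟨δ, h1, h2⟩ := hm.exists_scalarLift (autAb MHat γ)
      refine ⟨autAb MHat γ, ?_⟩
      rw [← h1, hm.braidSection_eq (by rw [h2, h1])]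
      refine (hm.out_eq_iff.2 ⟨h1.symm, q, ?_⟩).symm
      rw [h2, hd', hq']

/-- The action on the kernel is the natural one: scalars being invariant, `det` takes the value
`(det g) * g u` on representatives of both sides. -/
theorem IsBasis.braidSection_mul_reducedUnitToOut (g : ContAut AHat)
    (k : ReducedSpecialUnits AHat) :
    hm.braidSection g * hm.reducedUnitToOut k =
      hm.reducedUnitToOut (naturalAction AHat g k) * hm.braidSection g := by
  induction k using QuotientGroup.induction_on with
  | H u =>
    obtain ⟨γ, rfl, h1⟩ := hm.exists_scalarLift g
    obtain ⟨δ, h2, h3⟩ := hm.exists_kernelLift u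
    obtain ⟨δ', h4, h5⟩ := hm.exists_kernelLift (specialUnitsMap (autAb MHat γ) u)
    change hm.braidSection (autAb MHat γ) * hm.unitToOut u =
      hm.unitToOut (specialUnitsMap (autAb MHat γ) u) * hm.braidSection (autAb MHat γ)
    rw [hm.braidSection_eq h1, hm.unitToOut_eq h2 h3, hm.unitToOut_eq h4 h5,
      ← QuotientGroup.mk_mul, ← QuotientGroup.mk_mul]
    refine hm.out_eq_iff.2 ⟨?_, 1, ?_⟩
    · rw [map_mul, map_mul, h2, h4, mul_one, one_mul]
    · rw [hm.det_mul, hm.det_mul, h1, h3, h5, map_scalar, map_one, mul_one, mul_comm]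
      rfl

/-- The homomorphism `(k, g) ↦ ι k * s g` on the semidirect product. -/
def IsBasis.semidirectToOut :
    ReducedSpecialUnits AHat ⋊[naturalAction AHat] ContAut AHat →* Out MHat :=
  SemidirectProduct.lift hm.reducedUnitToOut hm.braidSection fun g => MonoidHom.ext fun k =>
    eq_mul_inv_of_mul_eq (hm.braidSection_mul_reducedUnitToOut g k).symm

theorem IsBasis.outAb_reducedUnitToOut (k : ReducedSpecialUnits AHat) :
    outAb MHat (hm.reducedUnitToOut k) = 1 := by
  rw [← MonoidHom.mem_ker, ← hm.range_reducedUnitToOut]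
  exact ⟨k, rfl⟩

theorem IsBasis.semidirectToOut_apply
    (p : ReducedSpecialUnits AHat ⋊[naturalAction AHat] ContAut AHat) :
    hm.semidirectToOut p = hm.reducedUnitToOut p.left * hm.braidSection p.right := rfl

theorem IsBasis.semidirectToOut_bijective : Function.Bijective hm.semidirectToOut := by
  have hab : ∀ p, outAb MHat (hm.semidirectToOut p) = p.right := fun p => by
    rw [hm.semidirectToOut_apply, map_mul, hm.outAb_reducedUnitToOut, hm.outAb_braidSection,
      one_mul]
  constructor
  · intro p q hpq
    have h1 : p.right = q.right := by rw [← hab, ← hab, hpq]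
    rw [hm.semidirectToOut_apply, hm.semidirectToOut_apply, h1] at hpq
    exact SemidirectProduct.ext (hm.reducedUnitToOut_injective (mul_right_cancel hpq)) h1
  · intro x
    have h1 : x * (hm.braidSection (outAb MHat x))⁻¹ ∈ (outAb MHat).ker := by
      rw [MonoidHom.mem_ker, map_mul, map_inv, hm.outAb_braidSection, mul_inv_cancel]
    rw [← hm.range_reducedUnitToOut] at h1
    obtain ⟨k, hk⟩ := h1
    refine ⟨⟨k, outAb MHat x⟩, ?_⟩
    rw [hm.semidirectToOut_apply, hk, inv_mul_cancel_right]

/-- The decomposition of `Out(M̂)` as a semidirect product. -/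
def IsBasis.outEquiv : Out MHat ≃* ReducedSpecialUnits AHat ⋊[naturalAction AHat] ContAut AHat :=
  (MulEquiv.ofBijective hm.semidirectToOut hm.semidirectToOut_bijective).symm

theorem IsBasis.outEquiv_symm_apply
    (p : ReducedSpecialUnits AHat ⋊[naturalAction AHat] ContAut AHat) :
    hm.outEquiv.symm p = hm.reducedUnitToOut p.left * hm.braidSection p.right := rfl

theorem IsBasis.isHomeomorph_outEquiv :
    IsHomeomorph fun x : Out MHat => ((hm.outEquiv x).left, (hm.outEquiv x).right) := by
  have : CompactSpace (ContAut AHat) := by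
    have h : Function.Surjective (autAb MHat) := fun g =>
      (hm.exists_scalarLift g).imp fun _ h => h.1
    exact h.compactSpace ContAut.continuous_autAb
  let e : ReducedSpecialUnits AHat × ContAut AHat ≃ Out MHat :=
    SemidirectProduct.equivProd.symm.trans hm.outEquiv.symm.toEquiv
  have he : Continuous e :=
    (hm.continuous_reducedUnitToOut.comp continuous_fst).mul
      (hm.continuous_braidSection.comp continuous_snd)
  exact (he.homeoOfEquivCompactToT2).symm.isHomeomorph

theorem IsBasis.outEquiv_image_braidLike :
    hm.outEquiv '' braidLike (m : MHat) =
      ((SemidirectProduct.inr : ContAut AHat →* _ ⋊[naturalAction AHat] _).range : Set _) := by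
  have h : ∀ g, hm.outEquiv (hm.braidSection g) = SemidirectProduct.inr g := fun g => by
    rw [← MulEquiv.eq_symm_apply, hm.outEquiv_symm_apply, SemidirectProduct.left_inr,
      SemidirectProduct.right_inr, map_one, one_mul]
  rw [← hm.range_braidSection]
  ext p
  constructor
  · rintro ⟨_, ⟨g, rfl⟩, rfl⟩
    exact ⟨g, (h g).symm⟩
  · rintro ⟨g, rfl⟩
    exact ⟨_, ⟨g, rfl⟩, h g⟩

end MHat

end

theorem mainTheorem5 (c : FreeMetabelian) (hc : IsDerivedBasis c) :
    (∀ γ : ContAut MHat, ∃! u : (CompletedGroupAlgebra AHat)ˣ, IsBachmuthDet (toMHat c) γ u) ∧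
    (∀ x : Out MHat, ∃! δ : ReducedUnits AHat, IsReducedDet (toMHat c) x δ) ∧
    (∀ g : ContAut AHat, ∃! d : ZHatˣ, HasDet g (d : ZHat)) ∧
    ∃ (ι : ReducedSpecialUnits AHat →* Out MHat) (s : ContAut AHat →* Out MHat)
      (Φ : Out MHat ≃* ReducedSpecialUnits AHat ⋊[naturalAction AHat] ContAut AHat),
      Continuous ι ∧ Continuous (outAb MHat) ∧ Continuous s ∧
      -- `ι` is the inverse of the reduced determinant on `ker ab_*`, and the sequence is exact
      (∀ u : specialUnits AHat,
        IsReducedDet (toMHat c) (ι (QuotientGroup.mk u)) (QuotientGroup.mk u.1)) ∧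
      Function.Injective ι ∧
      ι.range = (outAb MHat).ker ∧
      Function.Surjective (outAb MHat) ∧
      -- `s` is a section with image the braid-like outer automorphisms
      (outAb MHat).comp s = MonoidHom.id (ContAut AHat) ∧
      (s.range : Set (Out MHat)) = braidLike (toMHat c) ∧
      -- the semidirect product decomposition
      (∀ k g, Φ.symm ⟨k, g⟩ = ι k * s g) ∧
      IsHomeomorph (fun x : Out MHat => ((Φ x).left, (Φ x).right)) ∧
      Φ '' braidLike (toMHat c) =
        ((SemidirectProduct.inr : ContAut AHat →* _ ⋊[naturalAction AHat] _).range : Set _) := by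

  have hm := hc.isBasis
  refine ⟨fun γ => ⟨hm.detUnit γ, hm.isBachmuthDet_iff.2 rfl, fun u hu =>
      (hm.isBachmuthDet_iff.1 hu).symm⟩, fun x => ?_, fun g => ?_,
    hm.reducedUnitToOut, hm.braidSection, hm.outEquiv, hm.continuous_reducedUnitToOut,
    ContAut.continuous_outAb, hm.continuous_braidSection, hm.isReducedDet_reducedUnitToOut,
    hm.reducedUnitToOut_injective, hm.range_reducedUnitToOut,
    fun g => ⟨_, hm.outAb_braidSection g⟩, MonoidHom.ext hm.outAb_braidSection,
    hm.range_braidSection, fun k g => rfl, hm.isHomeomorph_outEquiv, hm.outEquiv_image_braidLike⟩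
  · induction x using QuotientGroup.induction_on with
    | H γ => exact ⟨_, hm.isReducedDet_mk.2 rfl, fun δ hδ => (hm.isReducedDet_mk.1 hδ).symm⟩
  · exact ⟨AHat.detUnit g, AHat.hasDet_det g, fun d hd =>
      Units.ext (AHat.hasDet_iff.1 hd).symm⟩
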